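/- Let $(A,\mathfrak m)$ be a (Noetherian) Cohen--Macaulay local ring with $d=\dim A>0$, and let $I$ be a canonical ideal of $A$, i.e. an ideal $I\neq A$ that is isomorphic, as an $A$-module, to a canonical module $\mathrm K_A$ of $A$. Let $Q=(a_1,\dots,a_d)$ be a parameter ideal of $A$ satisfying condition $(\sharp)$: $a_1\in I$, and $Q$ is a reduction of $J:=I+Q$ (that is, $J^{r+1}=QJ^r$ for some $r\ge 0$). Let $t$ be an indeterminate and put $\mathcal R=A[Jt]$, $\mathcal T=A[Qt]$ and $\mathcal B=\mathcal T/\mathfrak m\mathcal T$, and let $$\mathcal S=\mathcal S_Q(J)=J\mathcal R/J\mathcal T\cong\bigoplus_{i\ge 1}J^{i+1}/JQ^i$$ be the Sally module of $J$ with respect to $Q$, a graded $\mathcal T$-module. Its rank is $\operatorname{rank}\mathcal S=\ell_{\mathcal T_{\mathfrak p}}(\mathcal S_{\mathfrak p})$, where $\mathfrak p=\mathfrak m\mathcal T\in\operatorname{Spec}\mathcal T$. For an integer $n \ge 0$, the ring $A$ is called $n$-Goto with respect to $Q$ if $\mathcal S=\mathcal T\,[\mathcal S]_1$ and $\operatorname{rank}\mathcal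 S=n$. For a graded module $M$, $M(-1)$ denotes the shift with $[M(-1)]_j=M_{j-1}$. Theorem 11.8. Let $n\ge 1$ be an integer. The following conditions are equivalent. (1) $A$ is an $n$-Goto ring with respect to $Q$. (2) There exist integers $0\le \ell<n$ and $s_i\ge 1$ $(0\le i\le \ell)$ such that $n=\sum_{i=0}^{\ell}s_i$, there is an isomorphism $\mathfrak m^{\ell}\mathcal S\cong\mathcal B(-1)^{\oplus s_0}$ of graded $\mathcal T$-modules, and, if $\ell>0$, for every $0\le i<\ell$ there is an exact sequence $$0\to \mathfrak m^{i+1}\mathcal S\to\mathfrak m^{i}\mathcal S\to\mathcal B(-1)^{\oplus s_{\ell-i}}\to 0$$ of graded $\mathcal T$-modules. The equivalence holds both when the injections $\mathfrak m^{i+1}\mathcal S\to\mathfrak m^{i}\mathcal S$ in (2) are allowed to be arbitrary graded homomorphisms and when they are required to be the inclusion maps. When this is the case, with $\ell$ and $s_i$ as in (2) and $\ell>0$, there is an exact sequence $$0\to\mathcal B(-1)^{\oplus s_0}\to\mathfrak m^{\ell-1}\mathcal S\to\mathcal B(-1)^{\oplus s_1}\to 0$$ of graded $\mathcal T$-modules,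 and every such exact sequence is non-split. -/

import Mathlib

open Polynomial IsLocalRing CategoryTheory

universe u

noncomputable section

namespace GotoRing

/-! ### Cohen-Macaulay rings, canonical ideals, parameter ideals -/

section LocalAlgebra

variable {A : Type u} [CommRing A] [IsLocalRing A]

/-- A finitely generated module `M` over a Noetherian local ring `A` is maximal Cohen-Macaulay if
there is an `M`-regular sequence of length `dim A` in the maximal ideal. -/
def IsMaximalCohenMacaulay (A : Type u) [CommRing A] [IsLocalRing A]
    (M : Type u) [AddCommGroup M] [Module A M] : Prop :=
  Module.Finite A M ∧ ∃ rs : List A, (rs.length : WithBot ℕ∞) = ringKrullDim A ∧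
    (∀ r ∈ rs, r ∈ maximalIdeal A) ∧ RingTheory.Sequence.IsRegular M rs

/-- Cohen-Macaulay local rings. -/
def IsCohenMacaulayLocal (A : Type u) [CommRing A] [IsLocalRing A] : Prop :=
  IsNoetherianRing A ∧ IsMaximalCohenMacaulay A A

/-- A canonical module of a Cohen-Macaulay local ring `A`: a maximal Cohen-Macaulay module of
finite injective dimension and of type one, i.e. `Ext^d(A/𝔪, K)` has length one for `d = dim A`.
Any module isomorphic to a canonical module is one, and a canonical module is unique up to
isomorphism. -/
def IsCanonicalModule (A : Type u) [CommRing A] [IsLocalRing A]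
    (K : Type u) [AddCommGroup K] [Module A K] : Prop :=
  IsMaximalCohenMacaulay A K ∧
  (∃ m : ℕ, HasInjectiveDimensionLE (ModuleCat.of A K) m) ∧
  ∃ d : ℕ, ringKrullDim A = d ∧
    Module.length A
      (Abelian.Ext (ModuleCat.of A (A ⧸ maximalIdeal A)) (ModuleCat.of A K) d) = 1

/-- A canonical ideal: a proper ideal isomorphic, as a module, to a canonical module. -/
def IsCanonicalIdeal (I : Ideal A) : Prop :=
  I ≠ ⊤ ∧ ∃ (K : Type u) (_ : AddCommGroup K) (_ : Module A K),
    IsCanonicalModule A K ∧ Nonempty (I ≃ₗ[A] K)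

/-- `a₁, …, a_d` is a system of parameters of `A`: `d = dim A` and the ideal generated by the
`aᵢ` is `𝔪`-primary. -/
def IsSystemOfParameters {d : ℕ} (a : Fin d → A) : Prop :=
  ringKrullDim A = d ∧ (Ideal.span (Set.range a)).radical = maximalIdeal A

/-- `Q` is a reduction of `J`. -/
def IsReduction (Q J : Ideal A) : Prop :=
  Q ≤ J ∧ ∃ r : ℕ, J ^ (r + 1) = Q * J ^ r

/-- Condition `(♯)`: `Q` is a parameter ideal `(a₁, …, a_d)`, `d = dim A > 0`, such that `a₁ ∈ I`
and `Q` is a reduction of `I + Q`. -/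
def SatisfiesSharp (I Q : Ideal A) : Prop :=
  (∃ (e : ℕ) (a : Fin (e + 1) → A),
    IsSystemOfParameters a ∧ Q = Ideal.span (Set.range a) ∧ a 0 ∈ I) ∧
  IsReduction Q (I ⊔ Q)

end LocalAlgebra

/-! ### Gradings

A grading on a module `M` is given by its family of homogeneous components `ℳ j ⊆ M`, `j ∈ ℤ`. -/

section Gradings

variable {R M N P : Type*} [Ring R] [AddCommGroup M] [AddCommGroup N] [AddCommGroup P]
  [Module R M] [Module R N] [Module R P]

/-- The grading induced on a (homogeneous) submodule. -/
def subGrading (ℳ : ℤ → AddSubgroup M) (L : Submodule R M) : ℤ → AddSubgroup L :=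
  fun j => (ℳ j).comap L.subtype.toAddMonoidHom

/-- The grading induced on the quotient by a (homogeneous) submodule. -/
def quotGrading (ℳ : ℤ → AddSubgroup M) (L : Submodule R M) : ℤ → AddSubgroup (M ⧸ L) :=
  fun j => (ℳ j).map L.mkQ.toAddMonoidHom

/-- The shift `M(k)`: the `j`-th component of `M(k)` is `ℳ (k + j)`. -/
def shiftGrading (ℳ : ℤ → AddSubgroup M) (k : ℤ) : ℤ → AddSubgroup M :=
  fun j => ℳ (k + j)

/-- The grading of the direct sum `M^{⊕ s}`. -/
def powGrading (ℳ : ℤ → AddSubgroup M) (s : ℕ) : ℤ → AddSubgroup (Fin s → M) :=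
  fun j => AddSubgroup.pi Set.univ fun _ => ℳ j

/-- `f` is a homomorphism of graded modules (of degree zero). -/
def IsGradedHom (ℳ : ℤ → AddSubgroup M) (𝒩 : ℤ → AddSubgroup N) (f : M →ₗ[R] N) : Prop :=
  ∀ j, ∀ x ∈ ℳ j, f x ∈ 𝒩 j

/-- `0 → M → N → P → 0` is an exact sequence of graded modules. -/
structure IsGradedShortExact (ℳ : ℤ → AddSubgroup M) (𝒩 : ℤ → AddSubgroup N)
    (𝒬 : ℤ → AddSubgroup P) (f : M →ₗ[R] N) (g : N →ₗ[R] P) : Prop where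
  graded_left : IsGradedHom ℳ 𝒩 f
  graded_right : IsGradedHom 𝒩 𝒬 g
  injective : Function.Injective f
  exact : Function.Exact f g
  surjective : Function.Surjective g

/-- `M` and `N` are isomorphic as graded `R`-modules. -/
def GradedIso (R : Type*) {M N : Type*} [Ring R] [AddCommGroup M] [AddCommGroup N]
    [Module R M] [Module R N] (ℳ : ℤ → AddSubgroup M) (𝒩 : ℤ → AddSubgroup N) : Prop :=
  ∃ e : M ≃ₗ[R] N, ∀ j x, x ∈ ℳ j ↔ e x ∈ 𝒩 j

end Gradings

/-! ### Rees algebras and Sally modules -/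

section Sally

variable {A : Type u} [CommRing A]

/-- The `j`-th homogeneous component `A·t^j` of `A[t]` (zero for `j < 0`). -/
def polyGrading (A : Type u) [CommRing A] : ℤ → AddSubgroup A[X] := fun j =>
  { carrier := {f | ∀ k : ℕ, (k : ℤ) ≠ j → f.coeff k = 0}
    zero_mem' := fun k _ => coeff_zero k
    add_mem' := fun {f g} hf hg k hk => by rw [coeff_add, hf k hk, hg k hk, add_zero]
    neg_mem' := fun {f} hf k hk => by rw [coeff_neg, hf k hk, neg_zero] }

instance {Q : Ideal A} (N : Submodule (reesAlgebra Q) A[X]) : AddCommGroup N :=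
  N.addCommGroup

/-- The grading of the Rees algebra `𝒯 = A[Qt]`. -/
def reesGrading (Q : Ideal A) : ℤ → AddSubgroup (reesAlgebra Q) :=
  fun j => (polyGrading A j).comap (reesAlgebra Q).val.toLinearMap.toAddMonoidHom

/-- `J·ℛ(J) = ⊕_{i ≥ 0} J^{i+1} t^i`, as a module over `𝒯 = ℛ(Q)`, for `Q ⊆ J`. -/
def sallyNum {Q J : Ideal A} (h : Q ≤ J) : Submodule (reesAlgebra Q) A[X] where
  carrier := {f | ∀ i, f.coeff i ∈ J ^ (i + 1)}
  zero_mem' := fun i => by simp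
  add_mem' := fun {f g} hf hg i => by
    rw [coeff_add]; exact Ideal.add_mem _ (hf i) (hg i)
  smul_mem' := fun c f hf i => by
    rw [Subalgebra.smul_def, smul_eq_mul, coeff_mul]
    refine Ideal.sum_mem _ fun p hp => ?_
    rw [← Finset.HasAntidiagonal.mem_antidiagonal.mp hp, add_assoc, pow_add]
    exact Ideal.mul_mem_mul (Ideal.pow_right_mono h _ (c.2 p.1)) (hf p.2)

/-- `J·ℛ(Q) = ⊕_{i ≥ 0} J Q^i t^i`, as a module over `𝒯 = ℛ(Q)`. -/
def sallyDen (Q J : Ideal A) : Submodule (reesAlgebra Q) A[X] where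
  carrier := {f | ∀ i, f.coeff i ∈ J * Q ^ i}
  zero_mem' := fun i => by simp
  add_mem' := fun {f g} hf hg i => by
    rw [coeff_add]; exact Ideal.add_mem _ (hf i) (hg i)
  smul_mem' := fun c f hf i => by
    rw [Subalgebra.smul_def, smul_eq_mul, coeff_mul]
    refine Ideal.sum_mem _ fun p hp => ?_
    rw [← Finset.HasAntidiagonal.mem_antidiagonal.mp hp, pow_add, mul_left_comm]
    exact Ideal.mul_mem_mul (c.2 p.1) (hf p.2)

/-- The Sally module `𝒮_Q(J) = Jℛ(J)/Jℛ(Q) = ⊕_{i ≥ 1} J^{i+1}/JQ^i`, a module over `ℛ(Q)`. -/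
abbrev SallyModule {Q J : Ideal A} (h : Q ≤ J) : Type u :=
  sallyNum h ⧸ (sallyDen Q J).submoduleOf (sallyNum h)

/-- The grading of the Sally module: `[𝒮_Q(J)]_i = J^{i+1}/JQ^i`. -/
def sallyGrading {Q J : Ideal A} (h : Q ≤ J) : ℤ → AddSubgroup (SallyModule h) :=
  quotGrading (subGrading (polyGrading A) (sallyNum h)) _

variable [IsLocalRing A]

/-- The ideal `𝔪𝒯` of `𝒯 = ℛ(Q)`. -/
def maxRees (Q : Ideal A) : Ideal (reesAlgebra Q) :=
  (maximalIdeal A).map (algebraMap A (reesAlgebra Q))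

/-- The graded ring `ℬ = 𝒯/𝔪𝒯`. -/
abbrev FiberRing (Q : Ideal A) : Type u := reesAlgebra Q ⧸ maxRees Q

/-- The grading of `ℬ(-1)^{⊕ s}`. -/
def fiberGrading (Q : Ideal A) (s : ℕ) : ℤ → AddSubgroup (Fin s → FiberRing Q) :=
  powGrading (shiftGrading (quotGrading (reesGrading Q) (maxRees Q)) (-1)) s

/-- The graded submodule `𝔪^i 𝒮_Q(J)` of `𝒮_Q(J)`. -/
def sallyPow {Q J : Ideal A} (h : Q ≤ J) (i : ℕ) :
    Submodule (reesAlgebra Q) (SallyModule h) :=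
  (maxRees Q) ^ i • ⊤

theorem sallyPow_succ_le {Q J : Ideal A} (h : Q ≤ J) (i : ℕ) :
    sallyPow h (i + 1) ≤ sallyPow h i :=
  Submodule.smul_mono_left (Ideal.pow_le_pow_right i.le_succ)

/-- The grading of `𝔪^i 𝒮_Q(J)`. -/
def sallyPowGrading {Q J : Ideal A} (h : Q ≤ J) (i : ℕ) : ℤ → AddSubgroup (sallyPow h i) :=
  subGrading (sallyGrading h) (sallyPow h i)

/-- `rank 𝒮_Q(J) = n`: the ideal `𝔭 = 𝔪𝒯` is prime, and the localization of `𝒮_Q(J)` at `𝔭` has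
length `n` over `𝒯_𝔭`. (For a parameter ideal `Q` of a Cohen-Macaulay local ring `𝔭` is always
prime.) -/
def SallyRankEq {Q J : Ideal A} (h : Q ≤ J) (n : ℕ) : Prop :=
  ∃ _ : (maxRees Q).IsPrime,
    Module.length (Localization.AtPrime (maxRees Q))
      (LocalizedModule (maxRees Q).primeCompl (SallyModule h)) = n

/-- For `Q` satisfying `(♯)` and `J = I + Q`: the ring `A` is `n`-Goto with respect to `Q` if
`𝒮_Q(J) = 𝒯·[𝒮_Q(J)]₁` and `rank 𝒮_Q(J) = n`. -/
def IsGotoWithRespectTo (I Q : Ideal A) (n : ℕ) : Prop :=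
  Submodule.span (reesAlgebra Q)
      (sallyGrading (le_sup_right : Q ≤ I ⊔ Q) 1 : Set (SallyModule (le_sup_right : Q ≤ I ⊔ Q)))
    = ⊤ ∧
  SallyRankEq (le_sup_right : Q ≤ I ⊔ Q) n

/-- The integers `0 ≤ ℓ < n` and `s₀, …, s_ℓ ≥ 1` satisfy `n = s₀ + ⋯ + s_ℓ`,
`𝔪^ℓ 𝒮_Q(J) ≅ ℬ(-1)^{⊕ s₀}`, and for each `0 ≤ i < ℓ` there is an exact sequence
`0 → 𝔪^{i+1} 𝒮_Q(J) → 𝔪^i 𝒮_Q(J) → ℬ(-1)^{⊕ s_{ℓ-i}} → 0` of graded `𝒯`-modules. -/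
structure IsSallyFiltration {Q J : Ideal A} (h : Q ≤ J) (n ℓ : ℕ) (s : ℕ → ℕ) : Prop where
  lt : ℓ < n
  one_le : ∀ i ≤ ℓ, 1 ≤ s i
  sum_eq : n = ∑ i ∈ Finset.range (ℓ + 1), s i
  iso : GradedIso (reesAlgebra Q) (sallyPowGrading h ℓ) (fiberGrading Q (s 0))
  exact : ∀ i < ℓ,
    ∃ (f : sallyPow h (i + 1) →ₗ[reesAlgebra Q] sallyPow h i)
      (g : sallyPow h i →ₗ[reesAlgebra Q] (Fin (s (ℓ - i)) → FiberRing Q)),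
      IsGradedShortExact (sallyPowGrading h (i + 1)) (sallyPowGrading h i)
        (fiberGrading Q (s (ℓ - i))) f g

/-- As `IsSallyFiltration`, where moreover the injections `𝔪^{i+1} 𝒮_Q(J) → 𝔪^i 𝒮_Q(J)` in the
exact sequences are the inclusion maps. -/
def IsStrictSallyFiltration {Q J : Ideal A} (h : Q ≤ J) (n ℓ : ℕ) (s : ℕ → ℕ) : Prop :=
  IsSallyFiltration h n ℓ s ∧
  ∀ i < ℓ, ∃ g : sallyPow h i →ₗ[reesAlgebra Q] (Fin (s (ℓ - i)) → FiberRing Q),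
    IsGradedShortExact (sallyPowGrading h (i + 1)) (sallyPowGrading h i)
      (fiberGrading Q (s (ℓ - i))) (Submodule.inclusion (sallyPow_succ_le h i)) g

/-- `f : ℬ(-1)^{⊕ a} → 𝔪^i 𝒮_Q(J)` and `g : 𝔪^i 𝒮_Q(J) → ℬ(-1)^{⊕ b}` form an exact sequence
`0 → ℬ(-1)^{⊕ a} → 𝔪^i 𝒮_Q(J) → ℬ(-1)^{⊕ b} → 0` of graded `𝒯`-modules. -/
def IsFiberExtension {Q J : Ideal A} (h : Q ≤ J) (i a b : ℕ)
    (f : (Fin a → FiberRing Q) →ₗ[reesAlgebra Q] sallyPow h i)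
    (g : sallyPow h i →ₗ[reesAlgebra Q] (Fin b → FiberRing Q)) : Prop :=
  IsGradedShortExact (fiberGrading Q a) (sallyPowGrading h i) (fiberGrading Q b) f g

end Sally

end GotoRing

end

/-! The theorem holds because a Sally module `𝒮` that is generated in degree one is determined, as
far as its `𝔪`-adic filtration goes, by the finite-length module `[𝒮]₁ = J²/JQ`.

Write `Q = (a₀) + q` with `a₀ ∈ I`. Since `I` is a maximal Cohen-Macaulay module and `a₀, q` is a
regular sequence on both `A` and `I`, one has `I ∩ q = qI` and hence `J² ∩ q ⊆ qJ`. From this a form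
of degree `k` in the generators of `Q` with coefficients in `J²` can vanish only if its coefficients
lie in `JQ` (`GotoRing.SatisfiesSharp.exists_isQuasiRegular`); in other words the forms in the
generators of `Q` operate on `J²/JQ` without new relations. For the same reason `ℬ = 𝒯/𝔪𝒯` is a
domain, so that `𝔪𝒯` is prime (`isPrime_maxRees`).

If `𝒮 = 𝒯[𝒮]₁`, then `[𝔪ⁱ𝒮]_{k+1}` is the image of `(𝔪ⁱJ² + JQ) Qᵏ` (`sallyMk_mem_sallyPow_iff`).
A basis of the vector space `𝔪ⁱ[𝒮]₁/𝔪ⁱ⁺¹[𝒮]₁` is then a basis of `𝔪ⁱ𝒮/𝔪ⁱ⁺¹𝒮` over `ℬ`: it generates,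
and a relation between the basis elements is a form with coefficients in `J²` whose value lies in
`(𝔪ⁱ⁺¹J² + JQ) Qᵏ`, so after correction a vanishing form, to which the statement on forms applies
(`exists_fiber_quotient`). As some power of `𝔪` kills `J²/JQ`, and by Nakayama the filtration is
strictly decreasing until it vanishes, this yields condition (2) with inclusions as injections
(`exists_isStrictSallyFiltration`).

Conversely, along exact sequences with quotients `ℬ(-1)^{⊕ s}` generation in degree one lifts, since
a graded surjection onto `ℬ(-1)^{⊕ s}` hits the standard basis in degree one
(`span_sallyGrading_eq_top`), and localized lengths add up, each copy of `ℬ` contributing `1`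
(`sallyRankEq`). Finally, if the extension of `ℬ(-1)^{⊕ s₁}` by `ℬ(-1)^{⊕ s₀}` split, then `𝔪`
would kill `𝔪^{ℓ-1}𝒮`, although `𝔪^ℓ𝒮 ≅ ℬ(-1)^{⊕ s₀}` is not zero (`not_exists_section`). -/

noncomputable section

/-! ### Systems of parameters on maximal Cohen-Macaulay modules -/

section Parameters

variable {R : Type u} [CommRing R] [IsLocalRing R] [IsNoetherianRing R]

open RingTheory.Sequence Pointwise in
/-- The depth of a module is at most the dimension of `R ⧸ P` for each associated prime `P`. -/
theorem length_le_ringKrullDim_quotient_of_isAssociatedPrime (rs : List R)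
    (M : Type u) [AddCommGroup M] [Module R M] [Module.Finite R M]
    (hreg : IsRegular M rs) (hmem : ∀ r ∈ rs, r ∈ maximalIdeal R)
    (P : Ideal R) (hP : IsAssociatedPrime P M) :
    (rs.length : WithBot ℕ∞) ≤ ringKrullDim (R ⧸ P) := by
  induction rs generalizing M P with
  | nil =>
    have := hP.isPrime
    have : Nontrivial (R ⧸ P) := Ideal.Quotient.nontrivial_iff.mpr this.ne_top
    simpa using ringKrullDim_nonneg_of_nontrivial
  | cons x rs ih =>
    rw [isRegular_cons_iff] at hreg
    obtain ⟨hx, hreg⟩ := hreg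
    have hxm : x ∈ maximalIdeal R := hmem x List.mem_cons_self
    obtain ⟨hPp, z, hz⟩ := isAssociatedPrime_iff.mp hP
    have hmemP : ∀ r, r ∈ P ↔ r • z = 0 := fun r => by
      rw [hz, Submodule.mem_colon_singleton, Submodule.mem_bot]
    have hz0 : z ≠ 0 := by
      rintro rfl
      exact hPp.ne_top (Ideal.eq_top_iff_one _ |>.mpr ((hmemP 1).mpr (smul_zero _)))
    have hxP : x ∉ P := fun h => hz0 (hx (by simpa using (hmemP x).mp h))
    -- By Nakayama, not every element killed by `P` is divisible by `x`.
    obtain ⟨y, hyP, hyx⟩ : ∃ y : M, (∀ p ∈ P, p • y = 0) ∧ y ∉ x • (⊤ : Submodule R M) := by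
      by_contra! hcon
      let N : Submodule R M := Submodule.torsionBySet R M P
      have hN : ∀ y, y ∈ N ↔ ∀ p ∈ P, p • y = 0 := fun y => by
        simp [N, Submodule.mem_torsionBySet_iff]
      have hNle : N ≤ maximalIdeal R • N := by
        intro y hy
        obtain ⟨w, -, hw⟩ := hcon y ((hN y).mp hy)
        have hw' : x • w = y := hw
        have hwN : w ∈ N := (hN w).mpr fun p hp => hx (by
          change x • p • w = x • 0
          rw [smul_comm, hw', smul_zero, (hN y).mp hy p hp])
        rw [← hw']
        exact Submodule.smul_mem_smul hxm hwN
      have hbot : N = ⊥ := Submodule.eq_bot_of_le_smul_of_le_jacobson_bot _ N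
        (IsNoetherian.noetherian N) hNle (maximalIdeal_le_jacobson _)
      have : z ∈ N := (hN z).mpr fun p hp => (hmemP p).mp hp
      rw [hbot] at this
      exact hz0 this
    obtain ⟨P', hP', hle⟩ := exists_le_isAssociatedPrime_of_isNoetherianRing R
      (Submodule.Quotient.mk y : QuotSMulTop x M)
      (fun h => hyx ((Submodule.Quotient.mk_eq_zero _).mp h))
    have hPP' : P ≤ P' := fun p hp => hle (by
      rw [Submodule.mem_colon_singleton, Submodule.mem_bot, ← Submodule.Quotient.mk_smul,
        hyP p hp, Submodule.Quotient.mk_zero])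
    have hxP' : x ∈ P' := hle (by
      rw [Submodule.mem_colon_singleton, Submodule.mem_bot, ← Submodule.Quotient.mk_smul,
        Submodule.Quotient.mk_eq_zero]
      exact Submodule.smul_mem_pointwise_smul _ _ _ trivial)
    have h1 := ih (QuotSMulTop x M) hreg (fun r hr => hmem r (List.mem_cons_of_mem _ hr)) P' hP'
    have h2 : ringKrullDim (R ⧸ P') + 1 ≤ ringKrullDim (R ⧸ P) := by
      have hnz : Ideal.Quotient.mk P x ∈ nonZeroDivisors (R ⧸ P) :=
        mem_nonZeroDivisors_of_ne_zero (by rwa [Ne, Ideal.Quotient.eq_zero_iff_mem])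
      refine le_trans ?_ (ringKrullDim_quotient_succ_le_of_nonZeroDivisor hnz)
      gcongr
      let f : (R ⧸ P) ⧸ Ideal.span {Ideal.Quotient.mk P x} →+* R ⧸ P' :=
        Ideal.Quotient.lift _ (Ideal.Quotient.factor hPP') (by
          intro a ha
          have : Ideal.span {Ideal.Quotient.mk P x} ≤
              RingHom.ker (Ideal.Quotient.factor hPP') := by
            rw [Ideal.span_singleton_le_iff_mem, RingHom.mem_ker, Ideal.Quotient.factor_mk]
            exact Ideal.Quotient.eq_zero_iff_mem.mpr hxP'
          exact this ha)
      exact ringKrullDim_le_of_surjective f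
        (Ideal.Quotient.lift_surjective_of_surjective _ _ (Ideal.Quotient.factor_surjective hPP'))
    rw [List.length_cons]
    push_cast
    exact le_trans (by gcongr) h2

open RingTheory.Sequence Abelian Pointwise in
/-- Dividing out a regular element lowers the depth by at most one. -/
theorem exists_isRegular_quotSMulTop {M : Type u} [AddCommGroup M] [Module R M]
    [Module.Finite R M] {n : ℕ} {rs : List R} (hlen : rs.length = n + 1)
    (hreg : IsRegular M rs) (hmem : ∀ r ∈ rs, r ∈ maximalIdeal R)
    {a : R} (ha : a ∈ maximalIdeal R) (hareg : IsSMulRegular M a) :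
    ∃ ss : List R, ss.length = n ∧ (∀ r ∈ ss, r ∈ maximalIdeal R) ∧
      IsRegular (QuotSMulTop a M) ss := by
  have hM : Nontrivial M := hreg.nontrivial
  have hlt : ∀ (E : Type u) [AddCommGroup E] [Module R E] [Module.Finite R E] [Nontrivial E],
      maximalIdeal R • (⊤ : Submodule R E) < ⊤ := fun E _ _ _ _ =>
    lt_of_le_of_ne le_top fun h => by
      have := Submodule.eq_bot_of_le_smul_of_le_jacobson_bot (maximalIdeal R) (⊤ : Submodule R E)
        (Module.Finite.fg_top) h.ge (maximalIdeal_le_jacobson _)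
      exact top_ne_bot this
  let N : ModuleCat.{u} R := ModuleCat.of R (R ⧸ maximalIdeal R)
  have hsupp : Module.support R N = PrimeSpectrum.zeroLocus (maximalIdeal R) := by
    rw [Module.support_eq_zeroLocus, Ideal.annihilator_quotient]
  have hfin : Module.Finite R N := inferInstanceAs (Module.Finite R (R ⧸ maximalIdeal R))
  have hext := ModuleCat.subsingleton_ext_of_exists_isRegular (maximalIdeal R) N hsupp.subset
    (ModuleCat.of R M) (hlt M) rs hmem hreg
  have hnt : Nontrivial (QuotSMulTop a M) := by
    refine Submodule.Quotient.nontrivial_iff.mpr fun h => (hlt M).ne (top_le_iff.mp ?_)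
    calc (⊤ : Submodule R M) = a • ⊤ := h.symm
      _ = Ideal.span {a} • ⊤ := (Submodule.ideal_span_singleton_smul a ⊤).symm
      _ ≤ maximalIdeal R • ⊤ :=
        Submodule.smul_mono_left ((Ideal.span_singleton_le_iff_mem _).mpr ha)
  refine ModuleCat.exists_isRegular_of_exists_subsingleton_ext (maximalIdeal R) n
    (ModuleCat.of R (QuotSMulTop a M)) (hlt _) N hsupp fun i hi => ?_
  have zero1 := AddCommGrpCat.isZero_of_iff_subsingleton.mpr (hext i (by omega))
  have zero2 := AddCommGrpCat.isZero_of_iff_subsingleton.mpr (hext (i + 1) (by omega))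
  exact AddCommGrpCat.subsingleton_of_isZero <| ShortComplex.Exact.isZero_of_both_zeros
    ((Ext.covariant_sequence_exact₃' N
      (IsSMulRegular.smulShortComplex_shortExact (M := ModuleCat.of R M) hareg)) i (i + 1) rfl)
    (zero1.eq_zero_of_src _) (zero2.eq_zero_of_tgt _)

/-- A domain quotient whose maximal ideal is minimal over `n` elements has dimension at most
`n`. -/
theorem ringKrullDim_quotient_le_length (P : Ideal R) [hP : P.IsPrime] (as : List R)
    (has : ∀ a ∈ as, a ∈ maximalIdeal R)
    (h : ∀ P' : Ideal R, P'.IsPrime → P ≤ P' → Ideal.ofList as ≤ P' → P' = maximalIdeal R) :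
    ringKrullDim (R ⧸ P) ≤ as.length := by
  classical
  let π := Ideal.Quotient.mk P
  have : Nontrivial (R ⧸ P) := Ideal.Quotient.nontrivial_iff.mpr hP.ne_top
  have : IsLocalRing (R ⧸ P) := .of_surjective' π Ideal.Quotient.mk_surjective
  have hloc : IsLocalHom π := .of_surjective π Ideal.Quotient.mk_surjective
  have hcomap : (maximalIdeal (R ⧸ P)).comap π = maximalIdeal R :=
    IsLocalRing.maximalIdeal_comap π
  let s : Finset (R ⧸ P) := (as.map π).toFinset
  have hmin : maximalIdeal (R ⧸ P) ∈ (Ideal.span (s : Set (R ⧸ P))).minimalPrimes := by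
    refine ⟨⟨inferInstance, Ideal.span_le.mpr ?_⟩, fun P' hP' _ => ?_⟩
    · intro y hy
      obtain ⟨a, ha, rfl⟩ : ∃ a ∈ as, π a = y := by simpa [s] using hy
      have : a ∈ (maximalIdeal (R ⧸ P)).comap π := hcomap ▸ has a ha
      exact this
    · have := hP'.1
      have h1 : P'.comap π = maximalIdeal R := by
        refine h _ (Ideal.IsPrime.comap π) ?_ (Ideal.span_le.mpr fun a ha => ?_)
        · intro p hp
          rw [Ideal.mem_comap, Ideal.Quotient.eq_zero_iff_mem.mpr hp]
          exact zero_mem _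
        · exact hP'.2 (Ideal.subset_span (by
            have : a ∈ as := ha
            simpa [s] using ⟨a, this, rfl⟩))
      rw [← Ideal.map_comap_of_surjective π Ideal.Quotient.mk_surjective P', h1, ← hcomap]
      exact (Ideal.map_comap_of_surjective π Ideal.Quotient.mk_surjective _).ge
  rw [← IsLocalRing.maximalIdeal_height_eq_ringKrullDim]
  have h2 := Ideal.height_le_card_of_mem_minimalPrimes_span_finset hmin
  have h3 : s.card ≤ as.length := (List.toFinset_card_le _).trans (by simp)
  have h4 : (maximalIdeal (R ⧸ P)).height ≤ (as.length : ℕ∞) :=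
    h2.trans (by exact_mod_cast h3)
  exact_mod_cast h4

open RingTheory.Sequence Pointwise in
/-- If a finitely generated module has depth at least `n`, then `n` elements that cut its support
down to the closed point form a regular sequence, in the given order. -/
theorem isRegular_of_forall_isPrime_eq_maximalIdeal (as : List R)
    (M : Type u) [AddCommGroup M] [Module R M] [Module.Finite R M]
    {rs : List R} (hlen : rs.length = as.length)
    (hreg : IsRegular M rs) (hmem : ∀ r ∈ rs, r ∈ maximalIdeal R)
    (has : ∀ a ∈ as, a ∈ maximalIdeal R)
    (h : ∀ P : Ideal R, P.IsPrime → Module.annihilator R M ≤ P → Ideal.ofList as ≤ P →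
      P = maximalIdeal R) :
    IsRegular M as := by
  induction as generalizing M rs with
  | nil =>
    have : rs = [] := List.length_eq_zero_iff.mp hlen
    exact this ▸ hreg
  | cons a as ih =>
    have ham : a ∈ maximalIdeal R := has a List.mem_cons_self
    have has' : ∀ b ∈ as, b ∈ maximalIdeal R := fun b hb => has b (List.mem_cons_of_mem _ hb)
    rw [isRegular_cons_iff]
    have hareg : IsSMulRegular M a := by
      rw [isSMulRegular_iff_right_eq_zero_of_smul]
      by_contra! hcon
      obtain ⟨z, hz, hz0⟩ := hcon
      obtain ⟨P, hP, haP⟩ : ∃ P ∈ associatedPrimes R M, a ∈ P := by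
        have : a ∈ ⋃ p ∈ associatedPrimes R M, (p : Set R) := by
          rw [biUnion_associatedPrimes_eq_zero_divisors]
          exact ⟨z, hz0, hz⟩
        simpa using this
      have hPp := hP.isPrime
      have h1 := length_le_ringKrullDim_quotient_of_isAssociatedPrime rs M hreg hmem P hP
      have hann : Module.annihilator R M ≤ P := by
        have := hP.annihilator_le
        rwa [Submodule.annihilator_top] at this
      have h2 := ringKrullDim_quotient_le_length P as has' fun P' hP' hle hle' =>
        h P' hP' (hann.trans hle) (by
          rw [Ideal.ofList_cons]
          exact sup_le ((Ideal.span_singleton_le_iff_mem _).mpr (hle haP)) hle')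
      have h3 := h1.trans h2
      rw [hlen, List.length_cons] at h3
      have : as.length + 1 ≤ as.length := by exact_mod_cast h3
      omega
    refine ⟨hareg, ?_⟩
    obtain ⟨ss, hss, hssm, hssr⟩ := exists_isRegular_quotSMulTop
      (hlen.trans List.length_cons) hreg hmem ham hareg
    refine ih (QuotSMulTop a M) hss hssr hssm has' fun P hP hann hle => h P hP ?_ ?_
    · exact (LinearMap.annihilator_le_of_surjective _ (Submodule.mkQ_surjective _)).trans hann
    · rw [Ideal.ofList_cons]
      refine sup_le ((Ideal.span_singleton_le_iff_mem _).mpr (hann ?_)) hle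
      rw [Module.mem_annihilator]
      intro y
      induction y using Submodule.Quotient.induction_on with
      | H y =>
        rw [← Submodule.Quotient.mk_smul, Submodule.Quotient.mk_eq_zero]
        exact Submodule.smul_mem_pointwise_smul _ _ _ trivial

open RingTheory.Sequence in
/-- A system of parameters, in any order, is a regular sequence on a maximal Cohen-Macaulay
module. -/
theorem GotoRing.IsSystemOfParameters.isRegular {d : ℕ} {a : Fin d → R}
    (ha : GotoRing.IsSystemOfParameters a) {as : List R} (has : as.Perm (List.ofFn a))
    {M : Type u} [AddCommGroup M] [Module R M] (hM : GotoRing.IsMaximalCohenMacaulay R M) :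
    IsRegular M as := by
  obtain ⟨hdim, hrad⟩ := ha
  obtain ⟨hfin, rs, hlen, hmem, hreg⟩ := hM
  have hset : {r | r ∈ as} = Set.range a := by
    ext r
    simp [has.mem_iff, List.mem_ofFn]
  refine isRegular_of_forall_isPrime_eq_maximalIdeal as M ?_ hreg hmem ?_ ?_
  · rw [hdim] at hlen
    have : rs.length = d := by exact_mod_cast hlen
    simp [this, has.length_eq]
  · intro r hr
    rw [← hrad]
    exact Ideal.le_radical (Ideal.subset_span (hset ▸ hr))
  · intro P hP _ hle
    refine le_antisymm (le_maximalIdeal hP.ne_top) ?_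
    rw [← hrad, hP.radical_le_iff, ← hset]
    exact hle

end Parameters

/-! ### Quasi-regularity -/

section QuasiRegular

variable {A : Type u} [CommRing A]

/-- The ideal `K · (a₁, …, a_m)ᵏ` consists of the values at `a` of the forms of degree `k` with
coefficients in `K`. -/
theorem mem_mul_span_pow_iff {m : ℕ} (a : Fin m → A) (K : Ideal A) (k : ℕ) (y : A) :
    y ∈ K * Ideal.span (Set.range a) ^ k ↔
      ∃ F : MvPolynomial (Fin m) A, F.IsHomogeneous k ∧ F ∈ K.map MvPolynomial.C ∧
        MvPolynomial.eval a F = y := by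
  constructor
  · intro hy
    induction hy using Submodule.mul_induction_on' with
    | mem_mul_mem r hr s hs =>
      obtain ⟨p, hp, rfl⟩ := (Ideal.mem_span_pow_iff_exists_isHomogeneous a s).mp hs
      refine ⟨MvPolynomial.C r * p, ?_, ?_, by simp⟩
      · simpa using (MvPolynomial.isHomogeneous_C _ r).mul hp
      · exact Ideal.mul_mem_right _ _ (Ideal.mem_map_of_mem _ hr)
    | add x _ y _ hx hy =>
      obtain ⟨F, hF, hFK, rfl⟩ := hx
      obtain ⟨G, hG, hGK, rfl⟩ := hy
      exact ⟨F + G, hF.add hG, add_mem hFK hGK, by simp⟩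
  · rintro ⟨F, hF, hFK, rfl⟩
    rw [MvPolynomial.mem_map_C_iff] at hFK
    rw [F.as_sum, map_sum]
    refine sum_mem fun d hd => ?_
    have h1 : MvPolynomial.eval a (MvPolynomial.monomial d (1 : A)) ∈
        Ideal.span (Set.range a) ^ k :=
      (Ideal.mem_span_pow_iff_exists_isHomogeneous a _).mpr
        ⟨_, MvPolynomial.isHomogeneous_monomial _ (by
          rw [Finsupp.degree_eq_weight_one]
          exact hF (MvPolynomial.mem_support_iff.mp hd)), rfl⟩
    have h2 : MvPolynomial.monomial d (F.coeff d) =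
        MvPolynomial.C (F.coeff d) * MvPolynomial.monomial d (1 : A) := by
      rw [MvPolynomial.C_mul_monomial, mul_one]
    rw [h2, map_mul, MvPolynomial.eval_C]
    exact Ideal.mul_mem_mul (hFK d) h1

/-- A sequence is quasi-regular if every form vanishing at it has its coefficients in the ideal
that the sequence generates. -/
def IsQuasiRegular {m : ℕ} (a : Fin m → A) : Prop :=
  ∀ (k : ℕ) (F : MvPolynomial (Fin m) A), F.IsHomogeneous k → MvPolynomial.eval a F = 0 →
    F ∈ (Ideal.span (Set.range a)).map MvPolynomial.C

theorem IsQuasiRegular.mem_map_C {m : ℕ} {a : Fin m → A} (ha : IsQuasiRegular a) {k : ℕ}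
    {F : MvPolynomial (Fin m) A} (hF : F.IsHomogeneous k)
    (h : MvPolynomial.eval a F ∈ Ideal.span (Set.range a) ^ (k + 1)) :
    F ∈ (Ideal.span (Set.range a)).map MvPolynomial.C := by
  rw [pow_succ', mem_mul_span_pow_iff] at h
  obtain ⟨G, hG, hGm, hGe⟩ := h
  have := ha k (F - G) (hF.sub hG) (by rw [map_sub, hGe, sub_self])
  simpa using add_mem this hGm

/-- Let `q` be the ideal generated by a quasi-regular sequence `a` and let `a₀` be regular
modulo `q`. A form in `a₀, a` with coefficients in `N`, written as a sum of powers of `a₀` times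
forms in `a`, vanishes only if its coefficients lie in `D ⊇ (a₀) W + q W`, as soon as
`N ∩ q ⊆ q W` and `a₀ W ⊆ N`.

The part of lowest degree in `a` has coefficients in `N ∩ q`; it is a form of the next degree in
`a`, with coefficients in `W`, and one factor `a₀` moves from the power of `a₀` to the
coefficients. -/
theorem forall_mem_map_C_of_sum_eq_zero {m : ℕ} {a : Fin m → A} (ha : IsQuasiRegular a) {a₀ : A}
    (ha₀ : ∀ x, a₀ * x ∈ Ideal.span (Set.range a) → x ∈ Ideal.span (Set.range a))
    {N W D : Ideal A} (hNW : N ⊓ Ideal.span (Set.range a) ≤ Ideal.span (Set.range a) * W)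
    (hWN : ∀ w ∈ W, a₀ * w ∈ N) (hWD : ∀ w ∈ W, a₀ * w ∈ D)
    (hqD : Ideal.span (Set.range a) * W ≤ D) (k : ℕ) :
    ∀ (j : ℕ) (G : ℕ → MvPolynomial (Fin m) A), (∀ i ≤ k, (G i).IsHomogeneous (j + i)) →
      (∀ i ≤ k, G i ∈ N.map MvPolynomial.C) →
      ∑ i ∈ Finset.range (k + 1), a₀ ^ (k - i) * MvPolynomial.eval a (G i) = 0 →
      ∀ i ≤ k, G i ∈ D.map MvPolynomial.C := by
  have ha₀' : ∀ (n : ℕ) x, a₀ ^ n * x ∈ Ideal.span (Set.range a) →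
      x ∈ Ideal.span (Set.range a) := by
    intro n
    induction n with
    | zero => intro x hx; simpa using hx
    | succ n ih =>
      intro x hx
      exact ih _ (ha₀ _ (by rwa [← mul_assoc, ← pow_succ']))
  -- The coefficients of the part of lowest degree in `a` lie in `q`, hence in `q W`.
  have key : ∀ (k j : ℕ) (G : MvPolynomial (Fin m) A), G.IsHomogeneous j →
      G ∈ N.map MvPolynomial.C →
      a₀ ^ k * MvPolynomial.eval a G ∈ Ideal.span (Set.range a) ^ (j + 1) →
      G ∈ (Ideal.span (Set.range a) * W).map MvPolynomial.C := by
    intro k j G hG hGN h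
    have h1 : MvPolynomial.C (a₀ ^ k) * G ∈ (Ideal.span (Set.range a)).map MvPolynomial.C := by
      refine ha.mem_map_C (k := j) ?_ (by simpa using h)
      simpa using (MvPolynomial.isHomogeneous_C _ (a₀ ^ k)).mul hG
    rw [MvPolynomial.mem_map_C_iff] at h1 hGN ⊢
    exact fun d => hNW ⟨hGN d, ha₀' k _ (by simpa only [MvPolynomial.coeff_C_mul] using h1 d)⟩
  have hmono : ∀ {K K' : Ideal A}, K ≤ K' →
      (K.map MvPolynomial.C : Ideal (MvPolynomial (Fin m) A)) ≤ K'.map MvPolynomial.C :=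
    fun h => Ideal.map_mono h
  induction k with
  | zero =>
    intro j G hG hGN hsum i hi
    obtain rfl : i = 0 := by omega
    have h0 : MvPolynomial.eval a (G 0) = 0 := by simpa using hsum
    exact hmono hqD (key 0 j (G 0) (hG 0 le_rfl) (hGN 0 le_rfl) (by simp [h0]))
  | succ k ih =>
    intro j G hG hGN hsum
    rw [Finset.sum_range_succ'] at hsum
    simp only [Nat.sub_zero] at hsum
    have hmem : a₀ ^ (k + 1) * MvPolynomial.eval a (G 0) ∈
        Ideal.span (Set.range a) ^ (j + 1) := by
      rw [eq_neg_of_add_eq_zero_right hsum]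
      refine neg_mem (sum_mem fun i hi => Ideal.mul_mem_left _ _ ?_)
      refine Ideal.pow_le_pow_right (show j + 1 ≤ j + (i + 1) by omega) ?_
      exact (Ideal.mem_span_pow_iff_exists_isHomogeneous a _).mpr
        ⟨_, hG (i + 1) (by have := Finset.mem_range.mp hi; omega), rfl⟩
    have hG0 := key (k + 1) j (G 0) (hG 0 (by omega)) (hGN 0 (by omega)) hmem
    obtain ⟨H, hH, hHW, hHe⟩ : ∃ H : MvPolynomial (Fin m) A, H.IsHomogeneous (j + 1) ∧
        H ∈ W.map MvPolynomial.C ∧ MvPolynomial.eval a H = MvPolynomial.eval a (G 0) := by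
      rw [← mem_mul_span_pow_iff, pow_succ', ← mul_assoc, mul_comm W, mem_mul_span_pow_iff]
      exact ⟨G 0, hG 0 (by omega), hG0, rfl⟩
    have hCH : ∀ {K : Ideal A}, (∀ w ∈ W, a₀ * w ∈ K) →
        MvPolynomial.C a₀ * H ∈ K.map MvPolynomial.C := by
      intro K hK
      rw [MvPolynomial.mem_map_C_iff] at hHW ⊢
      intro d
      rw [MvPolynomial.coeff_C_mul]
      exact hK _ (hHW d)
    let G' : ℕ → MvPolynomial (Fin m) A := fun i =>
      if i = 0 then G 1 + MvPolynomial.C a₀ * H else G (i + 1)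
    have hrec := ih (j + 1) G' (by
        intro i hi
        rcases i with _ | i
        · exact (hG 1 (by omega)).add (by
            simpa using (MvPolynomial.isHomogeneous_C _ a₀).mul hH)
        · have := hG (i + 2) (by omega)
          rwa [show j + (i + 2) = j + 1 + (i + 1) by ring] at this) (by
        intro i hi
        rcases i with _ | i
        · exact add_mem (hGN 1 (by omega)) (hCH hWN)
        · exact hGN (i + 2) (by omega)) (by
        rw [Finset.sum_range_succ'] at hsum ⊢
        rw [← hsum]
        simp only [G', Nat.add_eq_zero_iff, one_ne_zero, and_false, if_false, if_true, map_add,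
          map_mul, MvPolynomial.eval_C, hHe, Nat.sub_zero, Nat.reduceSubDiff, zero_add,
          Nat.add_sub_cancel]
        ring)
    intro i hi
    rcases i with _ | _ | i
    · exact hmono hqD hG0
    · have := sub_mem (hrec 0 (by omega)) (hCH hWD)
      simpa [G'] using this
    · exact hrec (i + 1) (by omega)

/-- The form of `forall_mem_map_C_of_sum_eq_zero` for polynomials in all the variables. -/
theorem mem_map_C_of_eval_cons_eq_zero {m : ℕ} {a : Fin m → A} (ha : IsQuasiRegular a) {a₀ : A}
    (ha₀ : ∀ x, a₀ * x ∈ Ideal.span (Set.range a) → x ∈ Ideal.span (Set.range a))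
    {N W D : Ideal A} (hNW : N ⊓ Ideal.span (Set.range a) ≤ Ideal.span (Set.range a) * W)
    (hWN : ∀ w ∈ W, a₀ * w ∈ N) (hWD : ∀ w ∈ W, a₀ * w ∈ D)
    (hqD : Ideal.span (Set.range a) * W ≤ D) {k : ℕ} {F : MvPolynomial (Fin (m + 1)) A}
    (hF : F.IsHomogeneous k) (hFN : F ∈ N.map MvPolynomial.C)
    (h : MvPolynomial.eval (Fin.cons a₀ a : Fin (m + 1) → A) F = 0) :
    F ∈ D.map MvPolynomial.C := by
  let P := MvPolynomial.finSuccEquiv A m F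
  have hcoeff : ∀ (d : Fin (m + 1) →₀ ℕ), (P.coeff (d 0)).coeff d.tail = F.coeff d := fun d => by
    rw [MvPolynomial.finSuccEquiv_coeff_coeff, Finsupp.cons_tail]
  have hdeg : P.natDegree < k + 1 := by
    rw [MvPolynomial.natDegree_finSuccEquiv, Nat.lt_succ_iff]
    exact (MvPolynomial.degreeOf_le_totalDegree F 0).trans hF.totalDegree_le
  have hres := forall_mem_map_C_of_sum_eq_zero ha ha₀ hNW hWN hWD hqD k 0
    (fun i => P.coeff (k - i))
    (fun i hi => hF.finSuccEquiv_coeff_isHomogeneous _ _ (by omega))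
    (fun i _ => by
      rw [MvPolynomial.mem_map_C_iff] at hFN ⊢
      intro d
      rw [MvPolynomial.finSuccEquiv_coeff_coeff]
      exact hFN _) (by
      rw [MvPolynomial.eval_eq_eval_mv_eval', Polynomial.eval_eq_sum_range'
        (lt_of_le_of_lt (Polynomial.natDegree_map_le) hdeg)] at h
      rw [← h, ← Finset.sum_range_reflect]
      refine Finset.sum_congr rfl fun i hi => ?_
      have := Finset.mem_range.mp hi
      rw [Polynomial.coeff_map, mul_comm, Nat.add_sub_cancel, show k - (k - i) = i by omega])
  rw [MvPolynomial.mem_map_C_iff]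
  intro d
  rw [← hcoeff d]
  rcases le_or_gt (d 0) k with hd | hd
  · have := hres (k - d 0) (by omega)
    rw [MvPolynomial.mem_map_C_iff] at this
    simpa [show k - (k - d 0) = d 0 by omega] using this d.tail
  · rw [Polynomial.coeff_eq_zero_of_natDegree_lt (by omega)]
    simp

theorem ofList_reverse_ofFn {m : ℕ} (a : Fin m → A) :
    Ideal.ofList (List.ofFn a).reverse = Ideal.span (Set.range a) :=
  congrArg Ideal.span (Set.ext fun r => by simp)

/-- A regular sequence is quasi-regular. -/
theorem isQuasiRegular_of_isWeaklyRegular {m : ℕ} (a : Fin m → A)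
    (ha : RingTheory.Sequence.IsWeaklyRegular A (List.ofFn a).reverse) : IsQuasiRegular a := by
  induction m with
  | zero =>
    intro k F hF h
    rw [MvPolynomial.eq_C_of_isEmpty F, MvPolynomial.eval_C] at h
    rw [MvPolynomial.eq_C_of_isEmpty F, h, map_zero]
    exact zero_mem _
  | succ m ih =>
    obtain ⟨a₀, a, rfl⟩ : ∃ (a₀ : A) (b : Fin m → A), a = Fin.cons a₀ b :=
      ⟨a 0, Fin.tail a, (Fin.cons_self_tail a).symm⟩
    rw [List.ofFn_cons, List.reverse_cons,
      RingTheory.Sequence.isWeaklyRegular_append_iff,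
      RingTheory.Sequence.isWeaklyRegular_singleton_iff] at ha
    rw [ofList_reverse_ofFn, isSMulRegular_quotient_iff_mem_of_smul_mem] at ha
    have hrange : Ideal.span (Set.range (Fin.cons a₀ a : Fin (m + 1) → A)) =
        Ideal.span {a₀} ⊔ Ideal.span (Set.range a) := by
      rw [Fin.range_cons, Ideal.span_insert]
    intro k F hF h
    refine mem_map_C_of_eval_cons_eq_zero (N := ⊤) (W := ⊤) (ih a ha.1) (fun x hx => ?_)
      (by simp) (by simp) (fun w _ => ?_) ?_ hF
      (MvPolynomial.mem_map_C_iff.mpr fun _ => trivial) h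
    · have h := ha.2 x
      rw [smul_eq_mul, smul_eq_mul, Ideal.mul_top] at h
      exact h hx
    · rw [hrange]
      exact Ideal.mem_sup_left (Ideal.mul_mem_right _ _ (Ideal.mem_span_singleton_self _))
    · rw [hrange, Ideal.mul_top]
      exact le_sup_right

end QuasiRegular

/-! ### The condition (♯) -/

section Sharp

variable {A : Type u} [CommRing A] [IsLocalRing A]

open RingTheory.Sequence in
/-- What the condition (♯) is used for: `Q` is generated by a quasi-regular sequence at which a
form with coefficients in `(I + Q)²` vanishes only if its coefficients lie in `(I + Q) Q`.

With `Q = (a₀) + q` and `a₀ ∈ I`, this rests on `(I + Q)² ∩ q ⊆ q (I + Q)`, which comes from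
`I ∩ q ⊆ q I`: if `u ∈ I ∩ q`, then `a₀ u ∈ q I`, and `a₀` is regular on `I / q I`. -/
theorem GotoRing.SatisfiesSharp.exists_isQuasiRegular
    (hA : GotoRing.IsCohenMacaulayLocal A) {I Q : Ideal A} (hI : GotoRing.IsCanonicalIdeal I)
    (hQ : GotoRing.SatisfiesSharp I Q) :
    ∃ (m : ℕ) (a : Fin m → A), Q = Ideal.span (Set.range a) ∧ Q.radical = maximalIdeal A ∧
      IsQuasiRegular a ∧
      ∀ (k : ℕ) (F : MvPolynomial (Fin m) A), F.IsHomogeneous k →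
        F ∈ ((I ⊔ Q) ^ 2).map MvPolynomial.C → MvPolynomial.eval a F = 0 →
        F ∈ ((I ⊔ Q) * Q).map MvPolynomial.C := by
  have := hA.1
  obtain ⟨-, K, _, _, hK, ⟨φ⟩⟩ := hI
  obtain ⟨⟨e, a, ha, rfl, ha0⟩, -⟩ := hQ
  have hperm : ((List.ofFn a).reverse).Perm (List.ofFn a) := List.reverse_perm _
  have hregA := (ha.isRegular hperm hA.2).toIsWeaklyRegular
  have hregI := (φ.isWeaklyRegular_congr _).mpr (ha.isRegular hperm hK.1).toIsWeaklyRegular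
  refine ⟨e + 1, a, rfl, ha.2, isQuasiRegular_of_isWeaklyRegular a hregA, ?_⟩
  obtain ⟨a₀, b, rfl⟩ : ∃ (a₀ : A) (b : Fin e → A), a = Fin.cons a₀ b :=
    ⟨a 0, Fin.tail a, (Fin.cons_self_tail a).symm⟩
  rw [Fin.cons_zero] at ha0
  rw [List.ofFn_cons, List.reverse_cons, isWeaklyRegular_append_iff,
    isWeaklyRegular_singleton_iff, ofList_reverse_ofFn,
    isSMulRegular_quotient_iff_mem_of_smul_mem] at hregA hregI
  have hQe : Ideal.span (Set.range (Fin.cons a₀ b : Fin (e + 1) → A)) =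
      Ideal.span {a₀} ⊔ Ideal.span (Set.range b) := by
    rw [Fin.range_cons, Ideal.span_insert]
  rw [hQe]
  generalize hq : Ideal.span (Set.range b) = q at *
  have hJ : I ⊔ (Ideal.span {a₀} ⊔ q) = I ⊔ q := by
    rw [← sup_assoc, sup_eq_left.mpr ((Ideal.span_singleton_le_iff_mem I).mpr ha0)]
  rw [hJ]
  have hIq : I ⊓ q ≤ q * I := by
    rintro u ⟨huI, huq⟩
    have h1 : (⟨u, huI⟩ : I) ∈ (q • ⊤ : Submodule A I) := by
      refine hregI.2 _ ?_
      have : a₀ • (⟨u, huI⟩ : I) = u • (⟨a₀, ha0⟩ : I) := Subtype.ext (mul_comm _ _)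
      rw [this]
      exact Submodule.smul_mem_smul huq trivial
    have h2 := Submodule.mem_map_of_mem (f := I.subtype) h1
    rw [Submodule.map_smul'', Submodule.map_top, Submodule.range_subtype] at h2
    exact h2
  intro k F hF hFJ h
  refine mem_map_C_of_eval_cons_eq_zero (N := (I ⊔ q) ^ 2) (W := I ⊔ q)
    (isQuasiRegular_of_isWeaklyRegular b hregA.1) (fun x hx => ?_) ?_ (fun w hw => ?_)
    (fun w hw => ?_) ?_ hF hFJ h
  · rw [hq] at hx ⊢
    have h := hregA.2 x
    rw [smul_eq_mul, smul_eq_mul, Ideal.mul_top] at h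
    exact h hx
  · rw [hq]
    have hsq : (I ⊔ q) ^ 2 = I * I ⊔ q * (I ⊔ q) := by
      rw [sq, Ideal.sup_mul, Ideal.mul_sup, Ideal.mul_sup, mul_comm I q, sup_assoc,
        ← sup_assoc (q * I) (q * I), sup_idem]
    rw [hsq]
    rintro x ⟨hx, hxq⟩
    obtain ⟨u, hu, v, hv, rfl⟩ := Submodule.mem_sup.mp hx
    have hqq : q * (I ⊔ q) ≤ q := Ideal.mul_le_left
    have hII : I * I ≤ I := Ideal.mul_le_left
    have hqI : q * I ≤ q * (I ⊔ q) := Ideal.mul_mono_right le_sup_left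
    have huq : u ∈ q := (Submodule.add_mem_iff_left _ (hqq hv)).mp hxq
    exact add_mem (hqI (hIq ⟨hII hu, huq⟩)) hv
  · rw [sq]
    exact Ideal.mul_mem_mul (Ideal.mem_sup_left ha0) hw
  · rw [mul_comm a₀]
    exact Ideal.mul_mem_mul hw (Ideal.mem_sup_left (Ideal.mem_span_singleton_self _))
  · rw [hq, mul_comm q]
    exact Ideal.mul_mono_right le_sup_right

end Sharp

/-! ### The Rees algebra and its special fibre -/

section Rees

variable {A : Type u} [CommRing A]

/-- The element `c tᵏ` of `A[Qt]`, for `c ∈ Qᵏ`. -/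
def reesMonomial {Q : Ideal A} (k : ℕ) (c : A) (hc : c ∈ Q ^ k) : reesAlgebra Q :=
  ⟨monomial k c, reesAlgebra.monomial_mem.mpr hc⟩

variable [IsLocalRing A]

open GotoRing

theorem mem_maxRees_iff {Q : Ideal A} (f : reesAlgebra Q) :
    f ∈ maxRees Q ↔ ∀ k, f.1.coeff k ∈ maximalIdeal A * Q ^ k := by
  constructor
  · intro hf
    let K : Ideal (reesAlgebra Q) :=
      { carrier := {f | ∀ k, f.1.coeff k ∈ maximalIdeal A * Q ^ k}
        zero_mem' := fun k => by simp
        add_mem' := fun {f g} hf hg k => by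
          simpa using add_mem (hf k) (hg k)
        smul_mem' := fun c f hf k => by
          rw [smul_eq_mul, MulMemClass.coe_mul, coeff_mul]
          refine sum_mem fun p hp => ?_
          rw [← Finset.HasAntidiagonal.mem_antidiagonal.mp hp, pow_add, mul_left_comm]
          exact Ideal.mul_mem_mul (c.2 p.1) (hf p.2) }
    have hle : maxRees Q ≤ K := Ideal.map_le_iff_le_comap.mpr fun r hr k => by
      change (Polynomial.C r).coeff k ∈ _
      rw [coeff_C]
      split_ifs with hk
      · simpa [hk] using hr
      · exact zero_mem _
    exact hle hf
  · intro hf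
    have hle : ∀ k, maximalIdeal A * Q ^ k ≤ Q ^ k := fun k => Ideal.mul_le_right
    have hmono : ∀ (k : ℕ) (c : A) (hc : c ∈ maximalIdeal A * Q ^ k),
        reesMonomial k c (hle k hc) ∈ maxRees Q := by
      intro k c hc
      induction hc using Submodule.mul_induction_on' with
      | mem_mul_mem r hr s hs =>
        have : reesMonomial k (r * s) (Ideal.mul_mem_left _ _ hs) =
            algebraMap A (reesAlgebra Q) r * reesMonomial k s hs :=
          Subtype.ext (Polynomial.C_mul_monomial).symm
        exact this ▸ Ideal.mul_mem_right _ _ (Ideal.mem_map_of_mem _ hr)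
      | add x hx y hy h1 h2 =>
        have : reesMonomial k (x + y) (add_mem (hle k hx) (hle k hy)) =
            reesMonomial k x (hle k hx) + reesMonomial k y (hle k hy) :=
          Subtype.ext (map_add (monomial k) x y)
        exact this ▸ add_mem h1 h2
    have hsum : f = ∑ k ∈ f.1.support,
        reesMonomial k (f.1.coeff k) (hle k (hf k)) := by
      refine Subtype.ext ?_
      rw [AddSubmonoidClass.coe_finsetSum]
      exact f.1.as_sum_support
    rw [hsum]
    exact sum_mem fun k _ => hmono k _ (hf k)

/-- The special fibre `𝒯/𝔪𝒯` is a domain when `Q ⊆ 𝔪` is generated by a quasi-regular sequence.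
It is a polynomial ring over the residue field; here the product of the lowest components outside
`𝔪𝒯` of two elements is compared with a product of two forms. -/
theorem isPrime_maxRees {m : ℕ} {a : Fin m → A} (ha : IsQuasiRegular a)
    (hm : Ideal.span (Set.range a) ≤ maximalIdeal A) :
    (maxRees (Ideal.span (Set.range a))).IsPrime := by
  classical
  set Q := Ideal.span (Set.range a) with hQ
  have hform : ∀ (k : ℕ) (F : MvPolynomial (Fin m) A), F.IsHomogeneous k →
      MvPolynomial.eval a F ∈ maximalIdeal A * Q ^ k →
      F ∈ (maximalIdeal A).map MvPolynomial.C := by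
    intro k F hF h
    obtain ⟨G, hG, hGm, hGe⟩ := (mem_mul_span_pow_iff a _ k _).mp h
    have h1 := ha k (F - G) (hF.sub hG) (by rw [map_sub, hGe, sub_self])
    simpa using add_mem (Ideal.map_mono hm h1) hGm
  have hprime : ((maximalIdeal A).map
      (MvPolynomial.C : A →+* MvPolynomial (Fin m) A)).IsPrime :=
    (Ideal.Quotient.isDomain_iff_prime _).mp
      ((MvPolynomial.quotientEquivQuotientMvPolynomial (maximalIdeal A)).symm.toMulEquiv.isDomain
        (MvPolynomial (Fin m) (A ⧸ maximalIdeal A)))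
  refine ⟨fun h => ?_, fun {x y} hxy => ?_⟩
  · have h1 : (1 : reesAlgebra Q) ∈ maxRees Q := h ▸ trivial
    have h2 := (mem_maxRees_iff _).mp h1 0
    have h3 : (1 : A) ∈ maximalIdeal A := by simp at h2
    exact (Ideal.ne_top_iff_one _).mp Ideal.IsPrime.ne_top' h3
  · by_contra! hcon
    rw [mem_maxRees_iff, mem_maxRees_iff] at hcon
    push Not at hcon
    obtain ⟨hx, hy⟩ := hcon
    set k := Nat.find hx with hk
    set l := Nat.find hy with hl
    have hxk := Nat.find_spec hx
    have hyl := Nat.find_spec hy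
    rw [← hk] at hxk
    rw [← hl] at hyl
    have hprod : x.1.coeff k * y.1.coeff l ∈ maximalIdeal A * Q ^ (k + l) := by
      have h1 := (mem_maxRees_iff _).mp hxy (k + l)
      rw [MulMemClass.coe_mul, coeff_mul, ← Finset.add_sum_erase _ _
        (Finset.HasAntidiagonal.mem_antidiagonal.mpr rfl : (k, l) ∈ _)] at h1
      refine (Submodule.add_mem_iff_left _ (sum_mem fun p hp => ?_)).mp h1
      obtain ⟨hne, hp⟩ := Finset.mem_erase.mp hp
      have hp := Finset.HasAntidiagonal.mem_antidiagonal.mp hp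
      rw [← hp, pow_add]
      rcases lt_or_ge p.1 k with h | h
      · have := not_not.mp (Nat.find_min hx h)
        rw [← mul_assoc]
        exact Ideal.mul_mem_mul this (y.2 p.2)
      · have h' : p.2 < l := by
          by_contra h'
          exact hne (Prod.ext (by simp; omega) (by simp; omega))
        have := not_not.mp (Nat.find_min hy h')
        rw [mul_left_comm]
        exact Ideal.mul_mem_mul (x.2 p.1) this
    obtain ⟨F, hF, hFe⟩ := (Ideal.mem_span_pow_iff_exists_isHomogeneous a _).mp (x.2 k)
    obtain ⟨G, hG, hGe⟩ := (Ideal.mem_span_pow_iff_exists_isHomogeneous a _).mp (y.2 l)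
    have hFG := hform _ _ (hF.mul hG) (by rwa [map_mul, hFe, hGe])
    rcases hprime.mem_or_mem hFG with h | h
    · exact hxk ((mem_mul_span_pow_iff a _ k _).mpr ⟨F, hF, h, hFe⟩)
    · exact hyl ((mem_mul_span_pow_iff a _ l _).mpr ⟨G, hG, h, hGe⟩)

end Rees

/-! ### The Sally module in coordinates -/

section Coordinates

open GotoRing

variable {A : Type u} [CommRing A] {Q J : Ideal A} (h : Q ≤ J)

theorem monomial_mem_sallyNum {k : ℕ} {c : A} (hc : c ∈ J ^ (k + 1)) :
    monomial k c ∈ sallyNum h := fun i => by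
  rw [coeff_monomial]
  split_ifs with hk
  · exact hk ▸ hc
  · exact zero_mem _

theorem monomial_mem_polyGrading (k : ℕ) (c : A) : monomial k c ∈ polyGrading A k := fun i hi => by
  rw [coeff_monomial, if_neg (fun hk => hi (by rw [hk]))]

theorem reesMonomial_mem_reesGrading {k : ℕ} {c : A} (hc : c ∈ Q ^ k) :
    reesMonomial k c hc ∈ reesGrading Q k :=
  monomial_mem_polyGrading k c

/-- The class of `c tᵏ` in the Sally module, for `c ∈ J^{k+1}`. -/
def sallyMonomial (k : ℕ) (c : A) (hc : c ∈ J ^ (k + 1)) : SallyModule h :=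
  Submodule.Quotient.mk ⟨monomial k c, monomial_mem_sallyNum h hc⟩

theorem sallyMonomial_mem_sallyGrading {k : ℕ} {c : A} (hc : c ∈ J ^ (k + 1)) :
    sallyMonomial h k c hc ∈ sallyGrading h k :=
  ⟨_, monomial_mem_polyGrading k c, rfl⟩

theorem sallyMk_eq_zero_iff (f : sallyNum h) :
    (Submodule.Quotient.mk f : SallyModule h) = 0 ↔ ∀ i, f.1.coeff i ∈ J * Q ^ i := by
  rw [Submodule.Quotient.mk_eq_zero]
  rfl

theorem sallyMk_eq_sum (f : sallyNum h) :
    (Submodule.Quotient.mk f : SallyModule h) =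
      ∑ k ∈ f.1.support, sallyMonomial h k (f.1.coeff k) (f.2 k) := by
  have : f = ∑ k ∈ f.1.support, (⟨_, monomial_mem_sallyNum h (f.2 k)⟩ : sallyNum h) := by
    refine Subtype.ext ?_
    rw [AddSubmonoidClass.coe_finsetSum]
    exact f.1.as_sum_support
  conv_lhs => rw [this]
  exact map_sum ((sallyDen Q J).submoduleOf (sallyNum h)).mkQ _ _

/-- The Sally module is concentrated in positive degrees. -/
theorem eq_zero_of_mem_sallyGrading {j : ℤ} (hj : j ≤ 0) {x : SallyModule h}
    (hx : x ∈ sallyGrading h j) : x = 0 := by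
  obtain ⟨f, hf, rfl⟩ := hx
  refine (sallyMk_eq_zero_iff h f).mpr fun i => ?_
  rcases eq_or_ne i 0 with rfl | hi
  · simpa using f.2 0
  · have : f.1.coeff i = 0 := hf i (by omega)
    rw [this]
    exact zero_mem _

theorem smul_mem_sallyGrading {i j : ℤ} {u : reesAlgebra Q} (hu : u ∈ reesGrading Q i)
    {x : SallyModule h} (hx : x ∈ sallyGrading h j) : u • x ∈ sallyGrading h (i + j) := by
  obtain ⟨f, hf, rfl⟩ := hx
  refine ⟨⟨u.1 * f.1, (sallyNum h).smul_mem u f.2⟩, fun k hk => ?_, rfl⟩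
  change (u.1 * f.1).coeff k = 0
  rw [coeff_mul]
  have hf' : ∀ l : ℕ, (l : ℤ) ≠ j → f.1.coeff l = 0 := hf
  refine Finset.sum_eq_zero fun p hp => ?_
  have hp := Finset.HasAntidiagonal.mem_antidiagonal.mp hp
  by_cases h1 : (p.1 : ℤ) = i
  · rw [hf' p.2 (by omega), mul_zero]
  · have hu' : u.1.coeff p.1 = 0 := hu p.1 h1
    rw [hu', zero_mul]

theorem smul_sallyMonomial {k : ℕ} {c : A} (hc : c ∈ J ^ (k + 1)) (r : A) :
    r • sallyMonomial h k c hc = sallyMonomial h k (r * c) (Ideal.mul_mem_left _ r hc) :=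
  congrArg (Submodule.Quotient.mk (p := (sallyDen Q J).submoduleOf (sallyNum h)))
    (Subtype.ext (smul_monomial r k c))

theorem sallyMonomial_add {k : ℕ} {c c' : A} (hc : c ∈ J ^ (k + 1)) (hc' : c' ∈ J ^ (k + 1)) :
    sallyMonomial h k (c + c') (add_mem hc hc') =
      sallyMonomial h k c hc + sallyMonomial h k c' hc' :=
  congrArg (Submodule.Quotient.mk (p := (sallyDen Q J).submoduleOf (sallyNum h)))
    (Subtype.ext (map_add (monomial k) c c'))

/-- The `A[Qt]`-submodule of `A[t]` that has the component `J` in degree zero and `N Qᵏ` in degree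
`k + 1`. -/
def shiftedRees (Q J : Ideal A) {N : Ideal A} (hN : J * Q ≤ N) :
    Submodule (reesAlgebra Q) A[X] where
  carrier := {f | f.coeff 0 ∈ J ∧ ∀ k, f.coeff (k + 1) ∈ N * Q ^ k}
  zero_mem' := by simp
  add_mem' := fun {f g} hf hg => ⟨by simpa using add_mem hf.1 hg.1, fun k => by
    simpa using add_mem (hf.2 k) (hg.2 k)⟩
  smul_mem' := fun c f hf => by
    refine ⟨?_, fun k => ?_⟩
    · rw [Subalgebra.smul_def, smul_eq_mul, mul_coeff_zero]
      exact Ideal.mul_mem_left _ _ hf.1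
    · rw [Subalgebra.smul_def, smul_eq_mul, coeff_mul]
      refine sum_mem fun p hp => ?_
      have hp := Finset.HasAntidiagonal.mem_antidiagonal.mp hp
      rcases hp2 : p.2 with _ | l
      · have h1 : c.1.coeff p.1 * f.coeff 0 ∈ Q ^ (k + 1) * J :=
          Ideal.mul_mem_mul (by have := c.2 p.1; rwa [show p.1 = k + 1 by omega] at this ⊢) hf.1
        rw [mul_comm (Q ^ (k + 1)), pow_succ', ← mul_assoc] at h1
        exact Ideal.mul_mono_left hN h1
      · rw [show k = p.1 + l by omega, pow_add, mul_left_comm]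
        exact Ideal.mul_mem_mul (c.2 p.1) (hf.2 l)

/-- If the Sally module is generated in degree one, then `J^{k+2} = J² Qᵏ`. -/
theorem pow_le_of_span_eq_top
    (hgen : Submodule.span (reesAlgebra Q) (sallyGrading h 1 : Set (SallyModule h)) = ⊤) (k : ℕ) :
    J ^ (k + 2) ≤ J ^ 2 * Q ^ k := by
  intro c hc
  have hN : J * Q ≤ J ^ 2 := by
    rw [sq]
    exact Ideal.mul_mono_right h
  let D := ((shiftedRees Q J hN).submoduleOf (sallyNum h)).map
    ((sallyDen Q J).submoduleOf (sallyNum h)).mkQ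
  have hD : Submodule.span (reesAlgebra Q) (sallyGrading h 1 : Set (SallyModule h)) ≤ D := by
    refine Submodule.span_le.mpr ?_
    rintro _ ⟨f, hf, rfl⟩
    refine ⟨f, ⟨by simpa using f.2 0, fun l => ?_⟩, rfl⟩
    rcases l with _ | l
    · simpa using f.2 1
    · have : f.1.coeff (l + 1 + 1) = 0 := hf _ (by push_cast; omega)
      change f.1.coeff (l + 1 + 1) ∈ _
      rw [this]
      exact zero_mem _
  obtain ⟨f, hf, hfe⟩ : sallyMonomial h (k + 1) c hc ∈ D := hD (hgen ▸ trivial)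
  have hsub := (sallyMk_eq_zero_iff h (⟨monomial (k + 1) c, monomial_mem_sallyNum h hc⟩ - f)).mp
    (by rw [Submodule.Quotient.mk_sub]; exact sub_eq_zero.mpr hfe.symm) (k + 1)
  have h1 : c - f.1.coeff (k + 1) ∈ J * Q ^ (k + 1) := by simpa using hsub
  rw [pow_succ', ← mul_assoc] at h1
  simpa using add_mem (Ideal.mul_mono_left hN h1) (hf.2 k)

variable [IsLocalRing A]

theorem restrictScalars_sallyPow (i : ℕ) :
    (sallyPow h i).restrictScalars A = (maximalIdeal A) ^ i • (⊤ : Submodule A (SallyModule h)) := by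
  rw [sallyPow, maxRees, ← Ideal.map_pow, Ideal.smul_restrictScalars, Submodule.restrictScalars_top]

theorem smul_mem_sallyPow {i : ℕ} {r : A} (hr : r ∈ maximalIdeal A ^ i) (x : SallyModule h) :
    r • x ∈ sallyPow h i := by
  rw [← Submodule.restrictScalars_mem A, restrictScalars_sallyPow]
  exact Submodule.smul_mem_smul hr trivial

/-- `𝔪ⁱ𝒮` is a graded submodule. -/
theorem mem_iSup_inf_sallyGrading {i : ℕ} {x : SallyModule h} (hx : x ∈ sallyPow h i) :
    x ∈ ⨆ k : ℕ, (sallyPow h i).toAddSubgroup ⊓ sallyGrading h k := by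
  rw [← Submodule.restrictScalars_mem A, restrictScalars_sallyPow] at hx
  induction hx using Submodule.smul_induction_on' with
  | smul r hr x hx =>
    induction x using Submodule.Quotient.induction_on with
    | H f =>
      rw [sallyMk_eq_sum, Finset.smul_sum]
      refine sum_mem fun k _ => AddSubgroup.mem_iSup_of_mem k ⟨smul_mem_sallyPow h hr _, ?_⟩
      rw [smul_sallyMonomial]
      exact sallyMonomial_mem_sallyGrading h _
  | add x _ y _ hx hy => exact add_mem hx hy

/-- The ideal `𝔪ⁱ J² + JQ`, the preimage in `J²` of `𝔪ⁱ [𝒮]₁ ⊆ [𝒮]₁ = J² / JQ`. -/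
def degreeOneIdeal (Q J : Ideal A) (i : ℕ) : Ideal A :=
  maximalIdeal A ^ i * J ^ 2 ⊔ J * Q

theorem degreeOneIdeal_le (h : Q ≤ J) (i : ℕ) : degreeOneIdeal Q J i ≤ J ^ 2 :=
  sup_le Ideal.mul_le_right (by rw [sq]; exact Ideal.mul_mono_right h)

theorem maximalIdeal_mul_degreeOneIdeal_le (i : ℕ) :
    maximalIdeal A * degreeOneIdeal Q J i ≤ degreeOneIdeal Q J (i + 1) := by
  rw [degreeOneIdeal, degreeOneIdeal, Ideal.mul_sup, ← mul_assoc, ← pow_succ']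
  exact sup_le_sup_left Ideal.mul_le_right _

/-- If the Sally module is generated in degree one, then `[𝔪ⁱ𝒮]_{k+1}` is the image of
`(𝔪ⁱ J² + JQ) Qᵏ`. -/
theorem sallyMk_mem_sallyPow_iff (hpow : ∀ k, J ^ (k + 2) ≤ J ^ 2 * Q ^ k) (i : ℕ)
    (f : sallyNum h) :
    (Submodule.Quotient.mk f : SallyModule h) ∈ sallyPow h i ↔
      ∀ k, f.1.coeff (k + 1) ∈ degreeOneIdeal Q J i * Q ^ k := by
  have hN : J * Q ≤ degreeOneIdeal Q J i := le_sup_right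
  have hden : ∀ k, J * Q ^ (k + 1) ≤ degreeOneIdeal Q J i * Q ^ k := fun k => by
    rw [pow_succ', ← mul_assoc]
    exact Ideal.mul_mono_left hN
  constructor
  · intro hf
    let D := ((shiftedRees Q J hN).submoduleOf (sallyNum h)).map
      ((sallyDen Q J).submoduleOf (sallyNum h)).mkQ
    have hD : Submodule.Quotient.mk f ∈ D := by
      rw [← Submodule.restrictScalars_mem A, restrictScalars_sallyPow] at hf
      generalize (Submodule.Quotient.mk f : SallyModule h) = x at hf
      induction hf using Submodule.smul_induction_on' with
      | smul r hr x hx =>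
        induction x using Submodule.Quotient.induction_on with
        | H f =>
          refine ⟨r • f, ⟨?_, fun k => ?_⟩, rfl⟩
          · have : r * f.1.coeff 0 ∈ J := Ideal.mul_mem_left _ _ (by simpa using f.2 0)
            simpa using this
          · have h1 : r * f.1.coeff (k + 1) ∈ maximalIdeal A ^ i * (J ^ 2 * Q ^ k) :=
              Ideal.mul_mem_mul hr (hpow k (f.2 (k + 1)))
            rw [← mul_assoc] at h1
            have h2 : maximalIdeal A ^ i * J ^ 2 * Q ^ k ≤ degreeOneIdeal Q J i * Q ^ k :=
              Ideal.mul_mono_left le_sup_left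
            simpa using h2 h1
      | add x _ y _ hx hy => exact add_mem hx hy
    obtain ⟨g, hg, hge⟩ := hD
    intro k
    have hsub := (sallyMk_eq_zero_iff h (f - g)).mp
      (by rw [Submodule.Quotient.mk_sub]; exact sub_eq_zero.mpr hge.symm) (k + 1)
    have h1 : f.1.coeff (k + 1) - g.1.coeff (k + 1) ∈ J * Q ^ (k + 1) := by simpa using hsub
    simpa using add_mem (hden k h1) (hg.2 k)
  · intro hf
    rw [sallyMk_eq_sum]
    refine sum_mem fun k _ => ?_
    have hzero : ∀ (k : ℕ) (c : A) (hc : c ∈ J ^ (k + 1)), c ∈ J * Q ^ k →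
        sallyMonomial h k c hc = 0 := fun k c hc hc' => (sallyMk_eq_zero_iff h _).mpr fun l => by
      change (monomial k c).coeff l ∈ _
      rw [coeff_monomial]
      split_ifs with hl
      · exact hl ▸ hc'
      · exact zero_mem _
    rcases k with _ | k
    · rw [hzero 0 _ _ (by simpa using f.2 0)]
      exact zero_mem _
    · have hle : ∀ c ∈ J ^ 2 * Q ^ k, c ∈ J ^ (k + 1 + 1) := fun c hc => by
        rw [show k + 1 + 1 = 2 + k by ring, pow_add]
        exact Ideal.mul_mono_right (Ideal.pow_right_mono h k) hc
      have hle' : maximalIdeal A ^ i * J ^ 2 * Q ^ k ≤ J ^ 2 * Q ^ k :=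
        Ideal.mul_mono_left Ideal.mul_le_right
      have hmem : ∀ (c : A) (hc : c ∈ maximalIdeal A ^ i * (J ^ 2 * Q ^ k)),
          sallyMonomial h (k + 1) c (hle c (hle' (by rwa [mul_assoc]))) ∈ sallyPow h i := by
        intro c hc
        induction hc using Submodule.mul_induction_on' with
        | mem_mul_mem r hr s hs =>
          have := smul_mem_sallyPow h hr (sallyMonomial h (k + 1) s (hle s hs))
          rwa [smul_sallyMonomial] at this
        | add x hx y hy h1 h2 =>
          rw [sallyMonomial_add h (hle x (hle' (by rwa [mul_assoc])))
            (hle y (hle' (by rwa [mul_assoc])))]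
          exact add_mem h1 h2
      have hfk := hf k
      rw [degreeOneIdeal, Ideal.sup_mul, mul_assoc (J : Ideal A), ← pow_succ'] at hfk
      obtain ⟨c, hc, c', hc', hcc⟩ := Submodule.mem_sup.mp hfk
      have hc2 : c' ∈ J ^ (k + 1 + 1) := by
        rw [pow_succ']
        exact Ideal.mul_mono_right (Ideal.pow_right_mono h _) hc'
      have hsplit : sallyMonomial h (k + 1) (f.1.coeff (k + 1)) (f.2 (k + 1)) =
          sallyMonomial h (k + 1) c (hle c (hle' hc)) + sallyMonomial h (k + 1) c' hc2 := by
        rw [← sallyMonomial_add]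
        congr 1
        exact hcc.symm
      rw [hsplit, hzero (k + 1) c' hc2 hc', add_zero]
      exact hmem c (by rwa [← mul_assoc])

end Coordinates

/-! ### The successive quotients of the filtration -/

section Quotients

open GotoRing

/-- A basis of the vector space `N / N'` over the residue field, lifted to `N`. -/
theorem exists_basis_mod {A : Type u} [CommRing A] [IsLocalRing A] {N N' : Ideal A}
    (hm : maximalIdeal A * N ≤ N') (hfg : N.FG) :
    ∃ (s : ℕ) (x : Fin s → A), (∀ j, x j ∈ N) ∧ N ≤ Ideal.span (Set.range x) ⊔ N' ∧
      ∀ c : Fin s → A, ∑ j, c j * x j ∈ N' → ∀ j, c j ∈ maximalIdeal A := by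
  let V := N ⧸ (N'.submoduleOf N : Submodule A N)
  have htors : Module.IsTorsionBySet A V (maximalIdeal A : Set A) := by
    rintro v ⟨r, hr⟩
    induction v using Submodule.Quotient.induction_on with
    | H y =>
      change Submodule.Quotient.mk (r • y) = 0
      rw [Submodule.Quotient.mk_eq_zero]
      exact hm (Ideal.mul_mem_mul hr y.2)
  let _ : Module (A ⧸ maximalIdeal A) V := htors.module
  have : IsScalarTower A (A ⧸ maximalIdeal A) V := htors.isScalarTower
  let _ : Field (A ⧸ maximalIdeal A) := Ideal.Quotient.field _
  have : Module.Finite A N := Module.Finite.iff_fg.mpr hfg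
  have : Module.Finite (A ⧸ maximalIdeal A) V := Module.Finite.of_restrictScalars_finite A _ _
  let b := Module.finBasis (A ⧸ maximalIdeal A) V
  choose y hy using fun j => Submodule.Quotient.mk_surjective (N'.submoduleOf N) (b j)
  have hsmul : ∀ (r : A) (v : V), (Ideal.Quotient.mk (maximalIdeal A) r) • v = r • v :=
    fun r v => rfl
  refine ⟨_, fun j => (y j : A), fun j => (y j).2, fun z hz => ?_, fun c hc j => ?_⟩
  · let v : V := Submodule.Quotient.mk ⟨z, hz⟩
    choose r hr using fun j => Ideal.Quotient.mk_surjective (I := maximalIdeal A) (b.repr v j)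
    have h1 : Submodule.Quotient.mk (⟨z, hz⟩ - ∑ j, r j • y j) = (0 : V) := by
      rw [Submodule.Quotient.mk_sub, sub_eq_zero, ← Submodule.mkQ_apply _ (∑ j, r j • y j),
        map_sum]
      conv_lhs => rw [show Submodule.Quotient.mk ⟨z, hz⟩ = v from rfl, ← b.sum_repr v]
      refine Finset.sum_congr rfl fun j _ => ?_
      rw [map_smul, Submodule.mkQ_apply, hy, ← hr, hsmul]
    rw [Submodule.Quotient.mk_eq_zero] at h1
    have h2 : z - ∑ j, r j * (y j : A) ∈ N' := by
      have := h1
      simpa [Submodule.submoduleOf] using this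
    rw [← sub_add_cancel z (∑ j, r j * (y j : A))]
    exact add_mem (Ideal.mem_sup_right h2) (Ideal.mem_sup_left
      (sum_mem fun j _ => Ideal.mul_mem_left _ _ (Ideal.subset_span ⟨j, rfl⟩)))
  · have h1 : ∑ j, Ideal.Quotient.mk (maximalIdeal A) (c j) • b j = 0 := by
      have h2 : (Submodule.Quotient.mk (∑ j, c j • y j) : V) = 0 := by
        rw [Submodule.Quotient.mk_eq_zero]
        simpa [Submodule.submoduleOf] using hc
      rw [← h2, ← Submodule.mkQ_apply, map_sum]
      refine Finset.sum_congr rfl fun j _ => ?_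
      rw [map_smul, Submodule.mkQ_apply, hy, hsmul]
    exact Ideal.Quotient.eq_zero_iff_mem.mp
      (Fintype.linearIndependent_iff.mp b.linearIndependent _ h1 j)

/-- If `Rˢ → E / E'` is surjective with kernel `pˢ`, then `E / E' ≅ (R / p)ˢ`. -/
theorem exists_linearMap_pi_quotient {R E : Type*} [CommRing R] [AddCommGroup E] [Module R E]
    {p : Ideal R} {E' : Submodule R E} {s : ℕ} (L : (Fin s → R) →ₗ[R] E)
    (hL : ∀ u, L u ∈ E' ↔ ∀ j, u j ∈ p) (hsup : ∀ y, ∃ u, y - L u ∈ E') :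
    ∃ g : E →ₗ[R] (Fin s → R ⧸ p), (∀ u, g (L u) = fun j => Ideal.Quotient.mk p (u j)) ∧
      LinearMap.ker g = E' ∧ Function.Surjective g := by
  let π : (Fin s → R) →ₗ[R] (Fin s → R ⧸ p) :=
    LinearMap.pi fun j => p.mkQ ∘ₗ LinearMap.proj j
  let ρ : (Fin s → R) →ₗ[R] E ⧸ E' := E'.mkQ ∘ₗ L
  have hπ : Function.Surjective π := fun v => by
    choose u hu using fun j => Ideal.Quotient.mk_surjective (v j)
    exact ⟨u, funext hu⟩
  have hρ : Function.Surjective ρ := fun v => by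
    induction v using Submodule.Quotient.induction_on with
    | H y =>
      obtain ⟨u, hu⟩ := hsup y
      exact ⟨u, ((Submodule.Quotient.eq E').mpr hu).symm⟩
  have hker : LinearMap.ker ρ = LinearMap.ker π := by
    ext u
    rw [LinearMap.mem_ker, LinearMap.mem_ker]
    refine (Submodule.Quotient.mk_eq_zero E').trans ((hL u).trans ?_)
    rw [funext_iff]
    exact forall_congr' fun j => (Ideal.Quotient.eq_zero_iff_mem).symm
  let e : (E ⧸ E') ≃ₗ[R] (Fin s → R ⧸ p) :=
    (ρ.quotKerEquivOfSurjective hρ).symm ≪≫ₗ Submodule.quotEquivOfEq _ _ hker ≪≫ₗ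
      π.quotKerEquivOfSurjective hπ
  have he : ∀ u, e (E'.mkQ (L u)) = π u := fun u => by
    have h1 : (ρ.quotKerEquivOfSurjective hρ).symm (ρ u) = Submodule.Quotient.mk u := by
      rw [LinearEquiv.symm_apply_eq]
      rfl
    change π.quotKerEquivOfSurjective hπ (Submodule.quotEquivOfEq _ _ hker
      ((ρ.quotKerEquivOfSurjective hρ).symm (ρ u))) = π u
    rw [h1]
    rfl
  refine ⟨e.toLinearMap ∘ₗ E'.mkQ, he, ?_, e.surjective.comp E'.mkQ_surjective⟩
  rw [LinearEquiv.ker_comp, Submodule.ker_mkQ]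

variable {A : Type u} [CommRing A] {Q J : Ideal A} (h : Q ≤ J)

theorem exists_sum_smul_sallyMonomial {s : ℕ} {x : Fin s → A} (hx : ∀ j, x j ∈ J ^ (1 + 1))
    (u : Fin s → reesAlgebra Q) :
    ∃ f : sallyNum h, ∑ j, u j • sallyMonomial h 1 (x j) (hx j) = Submodule.Quotient.mk f ∧
      ∀ k, f.1.coeff (k + 1) = ∑ j, (u j).1.coeff k * x j := by
  have hmem : ∀ j, (u j).1 * monomial 1 (x j) ∈ sallyNum h := fun j =>
    (sallyNum h).smul_mem (u j) (monomial_mem_sallyNum h (hx j))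
  refine ⟨∑ j, ⟨_, hmem j⟩, ?_, fun k => ?_⟩
  · exact (map_sum ((sallyDen Q J).submoduleOf (sallyNum h)).mkQ _ _).symm
  · rw [AddSubmonoidClass.coe_finsetSum, finsetSum_coeff]
    exact Finset.sum_congr rfl fun j _ => coeff_mul_monomial _ _ _ _

variable [IsLocalRing A]

theorem mem_fiberGrading_iff {s : ℕ} {j : ℤ} (v : Fin s → FiberRing Q) :
    v ∈ fiberGrading Q s j ↔
      ∀ l, ∃ u ∈ reesGrading Q (-1 + j), Ideal.Quotient.mk (maxRees Q) u = v l :=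
  ⟨fun hv l => hv l trivial, fun hv l _ => hv l⟩

/-- Forms `v j` of degree `k` in the generators of `Q` that satisfy a relation over a basis `x` of
`(𝔪ⁱ J² + JQ) / (𝔪ⁱ⁺¹ J² + JQ)` have their coefficients in `𝔪`. -/
theorem mem_maximalIdeal_mul_pow_of_sum_mem (h : Q ≤ J) {m : ℕ} {a : Fin m → A}
    (hQ : Q = Ideal.span (Set.range a))
    (hform : ∀ (k : ℕ) (F : MvPolynomial (Fin m) A), F.IsHomogeneous k →
      F ∈ (J ^ 2).map MvPolynomial.C → MvPolynomial.eval a F = 0 →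
      F ∈ (J * Q).map MvPolynomial.C) {i s : ℕ} {x : Fin s → A}
    (hx : ∀ j, x j ∈ J ^ 2)
    (hind : ∀ c : Fin s → A, ∑ j, c j * x j ∈ degreeOneIdeal Q J (i + 1) →
      ∀ j, c j ∈ maximalIdeal A) {k : ℕ} {v : Fin s → A} (hv : ∀ j, v j ∈ Q ^ k)
    (hsum : ∑ j, v j * x j ∈ degreeOneIdeal Q J (i + 1) * Q ^ k) (j : Fin s) :
    v j ∈ maximalIdeal A * Q ^ k := by
  have hle : degreeOneIdeal Q J (i + 1) ≤ J ^ 2 := degreeOneIdeal_le h (i + 1)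
  have hJQ : J * Q ≤ degreeOneIdeal Q J (i + 1) := le_sup_right
  generalize degreeOneIdeal Q J (i + 1) = D at *
  subst hQ
  choose U hU hUe using fun j => (Ideal.mem_span_pow_iff_exists_isHomogeneous a _).mp (hv j)
  obtain ⟨G, hG, hGD, hGe⟩ := (mem_mul_span_pow_iff a _ k _).mp hsum
  have hS : (∑ j, MvPolynomial.C (x j) * U j).IsHomogeneous k :=
    MvPolynomial.IsHomogeneous.sum _ _ _ fun j _ => by
      simpa using (MvPolynomial.isHomogeneous_C _ (x j)).mul (hU j)
  have h2 := hform k (∑ j, MvPolynomial.C (x j) * U j - G) (hS.sub hG)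
    (sub_mem (sum_mem fun j _ => Ideal.mul_mem_right _ _ (Ideal.mem_map_of_mem _ (hx j)))
      (Ideal.map_mono hle hGD))
    (by
      rw [map_sub, map_sum, hGe, sub_eq_zero]
      refine Finset.sum_congr rfl fun j _ => ?_
      rw [map_mul, MvPolynomial.eval_C, hUe, mul_comm])
  have h3 := add_mem (Ideal.map_mono hJQ h2) hGD
  rw [sub_add_cancel, MvPolynomial.mem_map_C_iff] at h3
  refine (mem_mul_span_pow_iff a (maximalIdeal A) k _).mpr ⟨U j, hU j, ?_, hUe j⟩
  rw [MvPolynomial.mem_map_C_iff]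
  intro d
  refine hind (fun j => (U j).coeff d) ?_ j
  have hcoeff : ∑ j, (U j).coeff d * x j = (∑ j, MvPolynomial.C (x j) * U j).coeff d := by
    rw [MvPolynomial.coeff_sum]
    exact Finset.sum_congr rfl fun j _ => by rw [MvPolynomial.coeff_C_mul, mul_comm]
  rw [hcoeff]
  exact h3 d

set_option maxHeartbeats 1000000 in
/-- If the Sally module is generated in degree one, then `𝔪ⁱ𝒮 / 𝔪ⁱ⁺¹𝒮` is isomorphic to
`ℬ(-1)^{⊕ s}`, where `s` is the dimension of `𝔪ⁱ [𝒮]₁ / 𝔪ⁱ⁺¹ [𝒮]₁`. -/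
theorem exists_fiber_quotient [IsNoetherianRing A] (hpow : ∀ k, J ^ (k + 2) ≤ J ^ 2 * Q ^ k)
    {m : ℕ} {a : Fin m → A} (hQ : Q = Ideal.span (Set.range a))
    (hform : ∀ (k : ℕ) (F : MvPolynomial (Fin m) A), F.IsHomogeneous k →
      F ∈ (J ^ 2).map MvPolynomial.C → MvPolynomial.eval a F = 0 →
      F ∈ (J * Q).map MvPolynomial.C) (i : ℕ) :
    ∃ (s : ℕ) (g : sallyPow h i →ₗ[reesAlgebra Q] (Fin s → FiberRing Q)),
      IsGradedHom (sallyPowGrading h i) (fiberGrading Q s) g ∧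
      (∀ y, g y = 0 ↔ (y : SallyModule h) ∈ sallyPow h (i + 1)) ∧ Function.Surjective g ∧
      (∀ j, ∀ v ∈ fiberGrading Q s j, ∃ y ∈ sallyPowGrading h i j, g y = v) ∧
      (s = 0 → degreeOneIdeal Q J i ≤ degreeOneIdeal Q J (i + 1)) := by
  obtain ⟨s, x, hxD, hspan, hind⟩ := exists_basis_mod (maximalIdeal_mul_degreeOneIdeal_le i)
    (IsNoetherian.noetherian (degreeOneIdeal Q J i))
  have hxJ : ∀ j, x j ∈ J ^ (1 + 1) := fun j => degreeOneIdeal_le h i (hxD j)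
  have hX : ∀ j, sallyMonomial h 1 (x j) (hxJ j) ∈ sallyPow h i := fun j =>
    (sallyMk_mem_sallyPow_iff h hpow i _).mpr fun k => by
      change (monomial 1 (x j)).coeff (k + 1) ∈ _
      rw [coeff_monomial]
      split_ifs with hk
      · obtain rfl : k = 0 := by omega
        simpa using hxD j
      · exact zero_mem _
  let L : (Fin s → reesAlgebra Q) →ₗ[reesAlgebra Q] sallyPow h i :=
    Fintype.linearCombination (reesAlgebra Q)
      fun j => (⟨sallyMonomial h 1 (x j) (hxJ j), hX j⟩ : sallyPow h i)
  have hLval : ∀ u, (L u : SallyModule h) = ∑ j, u j • sallyMonomial h 1 (x j) (hxJ j) :=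
    fun u => by
      rw [Fintype.linearCombination_apply, AddSubmonoidClass.coe_finsetSum]
      rfl
  have hLgr : ∀ (j : ℤ) (u : Fin s → reesAlgebra Q), (∀ l, u l ∈ reesGrading Q (-1 + j)) →
      L u ∈ sallyPowGrading h i j := by
    intro j u hu
    change (L u : SallyModule h) ∈ sallyGrading h j
    rw [hLval]
    refine sum_mem fun l _ => ?_
    have := smul_mem_sallyGrading h (hu l) (sallyMonomial_mem_sallyGrading h (hxJ l))
    rwa [Nat.cast_one, neg_add_cancel_comm] at this
  have hLmem : ∀ u, L u ∈ (sallyPow h (i + 1)).submoduleOf (sallyPow h i) ↔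
      ∀ j, u j ∈ maxRees Q := by
    intro u
    change (L u : SallyModule h) ∈ sallyPow h (i + 1) ↔ _
    obtain ⟨f, hf, hfc⟩ := exists_sum_smul_sallyMonomial h hxJ u
    rw [hLval, hf, sallyMk_mem_sallyPow_iff h hpow]
    constructor
    · intro hk j
      refine (mem_maxRees_iff _).mpr fun k => ?_
      have h1 := hk k
      rw [hfc] at h1
      exact mem_maximalIdeal_mul_pow_of_sum_mem h hQ hform hxJ hind (fun j => (u j).2 k) h1 j
    · intro hu k
      rw [hfc]
      refine sum_mem fun j _ => ?_
      have h1 := Ideal.mul_mem_mul ((mem_maxRees_iff _).mp (hu j) k) (hxD j)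
      rw [mul_assoc, mul_comm (Q ^ k), ← mul_assoc] at h1
      exact Ideal.mul_mono_left (maximalIdeal_mul_degreeOneIdeal_le i) h1
  clear_value L
  -- Modulo `𝔪ⁱ⁺¹𝒮`, a homogeneous element is a combination of the `x j` with homogeneous
  -- coefficients.
  have hLsurj : ∀ (j : ℤ) (y : sallyPow h i), y ∈ sallyPowGrading h i j →
      ∃ u : Fin s → reesAlgebra Q, (∀ l, u l ∈ reesGrading Q (-1 + j)) ∧
        y - L u ∈ (sallyPow h (i + 1)).submoduleOf (sallyPow h i) := by
    intro j y hy
    rcases le_or_gt j 0 with hj | hj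
    · have : y = 0 := Subtype.ext (eq_zero_of_mem_sallyGrading h hj hy)
      exact ⟨0, fun l => zero_mem _, by rw [this, map_zero, sub_zero]; exact zero_mem _⟩
    · obtain ⟨k, rfl⟩ : ∃ k : ℕ, j = (k : ℤ) + 1 := ⟨(j - 1).toNat, by omega⟩
      obtain ⟨⟨f, hfJ⟩, hf, hfy⟩ := hy
      have hfy : (Submodule.Quotient.mk ⟨f, hfJ⟩ : SallyModule h) = y := hfy
      have hc := (sallyMk_mem_sallyPow_iff h hpow i _).mp (hfy ▸ y.2) k
      have h1 : degreeOneIdeal Q J i * Q ^ k ≤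
          Q ^ k • Ideal.span (Set.range x) ⊔ degreeOneIdeal Q J (i + 1) * Q ^ k := by
        rw [smul_eq_mul, mul_comm (Q ^ k), ← Ideal.sup_mul]
        exact Ideal.mul_mono_left hspan
      obtain ⟨c, hc1, c', hc', hcc⟩ := Submodule.mem_sup.mp (h1 hc)
      obtain ⟨v, hv, hve⟩ := (Submodule.mem_ideal_smul_span_iff_exists_sum _ _ _).mp hc1
      let u : Fin s → reesAlgebra Q := fun l => reesMonomial k (v l) (hv l)
      refine ⟨u, fun l => ?_, ?_⟩
      · rw [neg_add_cancel_comm_assoc]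
        exact reesMonomial_mem_reesGrading (hv l)
      · obtain ⟨F, hF, hFc⟩ := exists_sum_smul_sallyMonomial h hxJ u
        change (y : SallyModule h) - (L u : SallyModule h) ∈ sallyPow h (i + 1)
        rw [hLval, hF, ← hfy, ← Submodule.Quotient.mk_sub, sallyMk_mem_sallyPow_iff h hpow]
        intro l
        change (f - F.1).coeff (l + 1) ∈ _
        rw [coeff_sub, hFc]
        rcases eq_or_ne l k with rfl | hl
        · have h2 : ∑ j, (u j).1.coeff l * x j = c := by
            rw [← hve, Finsupp.sum_fintype _ _ (by simp)]
            refine Finset.sum_congr rfl fun j _ => ?_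
            change (monomial l (v j)).coeff l * x j = _
            rw [coeff_monomial_same, smul_eq_mul]
          rw [h2, ← hcc, add_sub_cancel_left]
          exact hc'
        · have h2 : ∑ j, (u j).1.coeff l * x j = 0 := by
            refine Finset.sum_eq_zero fun j _ => ?_
            change (monomial k (v j)).coeff l * x j = _
            rw [coeff_monomial_of_ne _ hl, zero_mul]
          have h3 : f.coeff (l + 1) = 0 := hf (l + 1) (by push_cast; omega)
          rw [h2, h3, sub_zero]
          exact zero_mem _
  obtain ⟨g, hgL, hgker, hgsurj⟩ := exists_linearMap_pi_quotient L hLmem fun y => by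
    obtain ⟨y, hy⟩ := y
    have := mem_iSup_inf_sallyGrading h hy
    have hex : ∃ u, y - (L u : SallyModule h) ∈ sallyPow h (i + 1) := by
      clear hy
      induction this using AddSubgroup.iSup_induction' with
      | hp k z hz =>
        obtain ⟨u, -, hu⟩ := hLsurj k ⟨z, hz.1⟩ hz.2
        exact ⟨u, hu⟩
      | h1 => exact ⟨0, by simp⟩
      | hadd z w _ _ hz hw =>
        obtain ⟨u, hu⟩ := hz
        obtain ⟨u', hu'⟩ := hw
        refine ⟨u + u', ?_⟩
        have := add_mem hu hu'
        rw [map_add, Submodule.coe_add]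
        convert this using 1
        abel
    exact hex
  have hker : ∀ z, z ∈ (sallyPow h (i + 1)).submoduleOf (sallyPow h i) ↔ g z = 0 := fun z => by
    rw [← hgker]
    exact LinearMap.mem_ker
  refine ⟨s, g, fun j y hy => ?_, fun y => (hker y).symm, hgsurj, fun j v hv => ?_, ?_⟩
  · obtain ⟨u, hu, hyu⟩ := hLsurj j y hy
    have hgy : g y = fun j => Ideal.Quotient.mk (maxRees Q) (u j) := by
      rw [← hgL, ← sub_eq_zero, ← map_sub]
      exact (hker _).mp hyu
    rw [hgy]
    exact (mem_fiberGrading_iff _).mpr fun l => ⟨u l, hu l, rfl⟩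
  · have hv' := (mem_fiberGrading_iff v).mp hv
    choose u hu hue using hv'
    exact ⟨L u, hLgr j u hu, (hgL u).trans (funext hue)⟩
  · rintro rfl
    simpa using hspan

end Quotients

/-! ### Lengths of localizations -/

section LocalizedLength

variable {R : Type*} [CommRing R] (p : Ideal R) [p.IsPrime]
  {M N P : Type*} [AddCommGroup M] [AddCommGroup N] [AddCommGroup P]
  [Module R M] [Module R N] [Module R P]

/-- The length of `M_𝔭` over `R_𝔭`. -/
def localizedLength (M : Type*) [AddCommGroup M] [Module R M] : ℕ∞ :=
  Module.length (Localization.AtPrime p) (LocalizedModule p.primeCompl M)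

theorem localizedLength_eq_add_of_exact {f : M →ₗ[R] N} {g : N →ₗ[R] P}
    (hf : Function.Injective f) (hfg : Function.Exact f g) (hg : Function.Surjective g) :
    localizedLength p N = localizedLength p M + localizedLength p P :=
  Module.length_eq_add_of_exact (LocalizedModule.map p.primeCompl f)
    (LocalizedModule.map p.primeCompl g)
    (IsLocalizedModule.map_injective p.primeCompl (LocalizedModule.mkLinearMap _ _)
      (LocalizedModule.mkLinearMap _ _) f hf)
    (IsLocalizedModule.map_surjective p.primeCompl (LocalizedModule.mkLinearMap _ _)
      (LocalizedModule.mkLinearMap _ _) g hg)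
    (LocalizedModule.map_exact p.primeCompl f g hfg)

theorem localizedLength_of_subsingleton [Subsingleton M] : localizedLength p M = 0 := by
  have : Subsingleton (LocalizedModule p.primeCompl M) := ⟨fun x y => by
    induction x with | _ a s
    induction y with | _ b t
    rw [Subsingleton.elim a 0, Subsingleton.elim b 0, LocalizedModule.zero_mk,
      LocalizedModule.zero_mk]⟩
  exact Module.length_eq_zero

theorem localizedLength_congr (e : M ≃ₗ[R] N) : localizedLength p M = localizedLength p N := by
  have h := localizedLength_eq_add_of_exact p (f := (0 : PUnit.{1} →ₗ[R] M)) (g := e.toLinearMap)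
    (fun _ _ _ => rfl) (fun y => ⟨fun hy => ⟨0, (e.map_eq_zero_iff.mp hy).symm⟩, by
      rintro ⟨_, rfl⟩
      simp⟩) e.surjective
  rw [h, localizedLength_of_subsingleton, zero_add]

theorem localizedLength_quotient_self : localizedLength p (R ⧸ p) = 1 := by
  have hsimple : IsSimpleModule (Localization.AtPrime p)
      (LocalizedModule p.primeCompl (R ⧸ p)) := by
    rw [isSimpleModule_iff_toSpanSingleton_surjective]
    refine ⟨⟨LocalizedModule.mk 1 1, 0, fun h => ?_⟩, fun x hx y => ?_⟩
    · rw [← LocalizedModule.zero_mk 1, LocalizedModule.mk_eq] at h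
      obtain ⟨u, hu⟩ := h
      have h1 : Ideal.Quotient.mk p u.1 = 0 := by
        simpa [Submonoid.smul_def, Algebra.smul_def] using hu
      exact u.2 (Ideal.Quotient.eq_zero_iff_mem.mp h1)
    · induction x with | _ b s
      induction y with | _ c t
      obtain ⟨b, rfl⟩ := Ideal.Quotient.mk_surjective b
      obtain ⟨c, rfl⟩ := Ideal.Quotient.mk_surjective c
      have hb : b ∈ p.primeCompl := fun hb => hx (by
        rw [Ideal.Quotient.eq_zero_iff_mem.mpr hb, LocalizedModule.zero_mk])
      refine ⟨Localization.mk (c * s.1) (⟨b, hb⟩ * t), ?_⟩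
      rw [LinearMap.toSpanSingleton_apply, LocalizedModule.mk_smul_mk, LocalizedModule.mk_eq]
      refine ⟨1, ?_⟩
      simp only [Submonoid.smul_def, Algebra.smul_def, Submonoid.coe_one, Submonoid.coe_mul,
        Ideal.Quotient.algebraMap_eq, map_mul, map_one, one_mul]
      ring
  exact Module.length_eq_one_iff.mpr hsimple

theorem localizedLength_pi (s : ℕ) : localizedLength p (Fin s → M) = s * localizedLength p M := by
  induction s with
  | zero => rw [localizedLength_of_subsingleton, Nat.cast_zero, zero_mul]
  | succ s ih =>
    rw [← localizedLength_congr p (Fin.consLinearEquiv R (fun _ : Fin (s + 1) => M)),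
      localizedLength_eq_add_of_exact p (f := LinearMap.inl R M (Fin s → M))
        (g := LinearMap.snd R M (Fin s → M)) LinearMap.inl_injective .inl_snd
        LinearMap.snd_surjective, ih, Nat.cast_succ, add_mul, one_mul, add_comm]

end LocalizedLength

/-! ### Generation, rank and extensions from a filtration -/

section Consequences

open GotoRing

variable {A : Type u} [CommRing A] [IsLocalRing A] {Q J : Ideal A} {h : Q ≤ J}

-- Shortcuts to instances that are otherwise found only after a long search.

local instance fiberModule : Module (reesAlgebra Q) (FiberRing Q) := Submodule.Quotient.module _

local instance fiberSMul : SMul (reesAlgebra Q) (FiberRing Q) := fiberModule.toSMul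

local instance fiberPiModule (s : ℕ) : Module (reesAlgebra Q) (Fin s → FiberRing Q) :=
  Pi.Function.module _ _ _

local instance fiberPiSMul (s : ℕ) : SMul (reesAlgebra Q) (Fin s → FiberRing Q) :=
  (fiberPiModule s).toSMul

local instance sallyModule : Module (reesAlgebra Q) (SallyModule h) := Submodule.Quotient.module _

local instance sallySMul : SMul (reesAlgebra Q) (SallyModule h) := sallyModule.toSMul

local instance sallyPowModule (i : ℕ) : Module (reesAlgebra Q) (sallyPow h i) :=
  (sallyPow h i).module

local instance sallyPowSMul (i : ℕ) : SMul (reesAlgebra Q) (sallyPow h i) :=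
  (sallyPowModule i).toSMul

theorem sallyPow_zero : sallyPow h 0 = ⊤ := by
  rw [sallyPow, pow_zero, Ideal.one_eq_top, Submodule.top_smul]

theorem sallyPow_succ (i : ℕ) : sallyPow h (i + 1) = maxRees Q • sallyPow h i := by
  rw [sallyPow, sallyPow, pow_succ', Submodule.mul_smul]

theorem maxRees_smul_eq_zero {s : ℕ} {r : reesAlgebra Q} (hr : r ∈ maxRees Q)
    (v : Fin s → FiberRing Q) : r • v = 0 := by
  funext l
  obtain ⟨t, ht⟩ := Ideal.Quotient.mk_surjective (v l)
  rw [Pi.smul_apply, ← ht]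
  exact Ideal.Quotient.eq_zero_iff_mem.mpr (Ideal.mul_mem_right t _ hr)

theorem single_mem_fiberGrading {s : ℕ} (l : Fin s) :
    (Pi.single l 1 : Fin s → FiberRing Q) ∈ fiberGrading Q s 1 := by
  rw [mem_fiberGrading_iff]
  intro l'
  rcases eq_or_ne l' l with rfl | hl
  · refine ⟨1, fun k hk => ?_, by rw [Pi.single_eq_same, map_one]⟩
    change (1 : A[X]).coeff k = 0
    rw [coeff_one, if_neg (by omega)]
  · exact ⟨0, zero_mem _, by rw [Pi.single_eq_of_ne hl, map_zero]⟩

theorem exists_eq_sum_smul_single {s : ℕ} (v : Fin s → FiberRing Q) :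
    ∃ t : Fin s → reesAlgebra Q, v = ∑ l, t l • (Pi.single l 1 : Fin s → FiberRing Q) := by
  choose t ht using fun l => Ideal.Quotient.mk_surjective (v l)
  refine ⟨t, ?_⟩
  rw [← Finset.univ_sum_single v]
  refine Finset.sum_congr rfl fun l _ => ?_
  rw [← Pi.single_smul, ← ht]
  congr 1
  exact (mul_one (Ideal.Quotient.mk (maxRees Q) (t l))).symm

/-- A homogeneous element of degree one has a homogeneous preimage under a graded
homomorphism. -/
theorem exists_mem_sallyPowGrading_eq {i s : ℕ}
    {g : sallyPow h i →ₗ[reesAlgebra Q] (Fin s → FiberRing Q)}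
    (hg : IsGradedHom (sallyPowGrading h i) (fiberGrading Q s) g) (y : sallyPow h i)
    (hy : g y ∈ fiberGrading Q s 1) : ∃ z ∈ sallyPowGrading h i 1, g z = g y := by
  -- Up to an element of degree one, `g y` has no component in degree one.
  have key : ∃ z ∈ sallyPowGrading h i 1, ∀ l, ∃ t : reesAlgebra Q, t.1.coeff 0 = 0 ∧
      Ideal.Quotient.mk (maxRees Q) t = g y l - g z l := by
    obtain ⟨y, hyi⟩ := y
    have hmem := mem_iSup_inf_sallyGrading h hyi
    have hex : ∃ hyi : y ∈ sallyPow h i, ∃ z ∈ sallyPowGrading h i 1, ∀ l,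
        ∃ t : reesAlgebra Q, t.1.coeff 0 = 0 ∧
          Ideal.Quotient.mk (maxRees Q) t = g ⟨y, hyi⟩ l - g z l := by
      clear hy hyi
      induction hmem using AddSubgroup.iSup_induction' with
      | hp k x hx =>
        refine ⟨hx.1, ?_⟩
        rcases eq_or_ne k 1 with rfl | hk
        · exact ⟨⟨x, hx.1⟩, hx.2, fun l => ⟨0, by simp, by simp⟩⟩
        · refine ⟨0, zero_mem _, fun l => ?_⟩
          obtain ⟨t, ht, hte⟩ := (mem_fiberGrading_iff _).mp (hg k ⟨x, hx.1⟩ hx.2) l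
          exact ⟨t, ht 0 (by push_cast; omega), by rw [hte, map_zero, Pi.zero_apply, sub_zero]⟩
      | h1 =>
        refine ⟨zero_mem _, 0, zero_mem _, fun l => ⟨0, by simp, ?_⟩⟩
        rw [map_zero]
        exact (sub_self _).symm
      | hadd x x' _ _ hx hx' =>
        obtain ⟨hxi, z, hz, hzt⟩ := hx
        obtain ⟨hxi', z', hz', hzt'⟩ := hx'
        refine ⟨add_mem hxi hxi', z + z', add_mem hz hz', fun l => ?_⟩
        obtain ⟨t, ht, hte⟩ := hzt l
        obtain ⟨t', ht', hte'⟩ := hzt' l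
        refine ⟨t + t', ?_, ?_⟩
        · change (t.1 + t'.1).coeff 0 = 0
          rw [coeff_add, ht, ht', add_zero]
        · have : (⟨x + x', add_mem hxi hxi'⟩ : sallyPow h i) = ⟨x, hxi⟩ + ⟨x', hxi'⟩ := rfl
          rw [map_add, hte, hte', this, map_add, map_add, Pi.add_apply, Pi.add_apply]
          abel
    exact hex.2
  obtain ⟨z, hz, hzt⟩ := key
  refine ⟨z, hz, ?_⟩
  rw [eq_comm, ← sub_eq_zero]
  funext l
  obtain ⟨t, ht, hte⟩ := hzt l
  obtain ⟨t', ht', hte'⟩ := (mem_fiberGrading_iff _).mp (sub_mem hy (hg 1 z hz)) l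
  have h1 : t' - t ∈ maxRees Q := by
    rw [← Ideal.Quotient.eq_zero_iff_mem, map_sub, hte, hte']
    exact sub_self _
  have h2 := (mem_maxRees_iff _).mp h1 0
  have h3 : (t' - t).1.coeff 0 = t'.1.coeff 0 := by
    change (t'.1 - t.1).coeff 0 = _
    rw [coeff_sub, ht, sub_zero]
  rw [h3] at h2
  rw [← hte']
  refine Ideal.Quotient.eq_zero_iff_mem.mpr ((mem_maxRees_iff _).mpr fun k => ?_)
  rcases eq_or_ne k 0 with rfl | hk
  · exact h2
  · have : t'.1.coeff k = 0 := ht' k (by omega)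
    rw [this]
    exact zero_mem _

theorem span_sallyPowGrading_eq_top {n ℓ : ℕ} {s : ℕ → ℕ} (hs : IsSallyFiltration h n ℓ s)
    (i j : ℕ) (hij : i + j = ℓ) :
    Submodule.span (reesAlgebra Q) (sallyPowGrading h j 1 : Set (sallyPow h j)) = ⊤ := by
  induction i generalizing j with
  | zero =>
    obtain rfl : j = ℓ := by omega
    obtain ⟨e, he⟩ := hs.iso
    refine eq_top_iff.mpr fun y _ => ?_
    obtain ⟨t, ht⟩ := exists_eq_sum_smul_single (e y)
    have hy : y = ∑ l, t l • e.symm (Pi.single l 1) := by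
      rw [← e.symm_apply_apply y, ht, map_sum]
      exact Finset.sum_congr rfl fun l _ => map_smul _ _ _
    rw [hy]
    refine sum_mem fun l _ => Submodule.smul_mem _ _ (Submodule.subset_span ?_)
    refine (he _ _).mpr ?_
    rw [LinearEquiv.apply_symm_apply]
    exact single_mem_fiberGrading l
  | succ i ih =>
    obtain ⟨f, g, hfg⟩ := hs.exact j (by omega)
    refine eq_top_iff.mpr fun y _ => ?_
    obtain ⟨t, ht⟩ := exists_eq_sum_smul_single (g y)
    have hlift : ∀ l, ∃ z ∈ sallyPowGrading h j 1, g z = Pi.single l 1 := fun l => by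
      obtain ⟨z, hz⟩ := hfg.surjective (Pi.single l 1)
      obtain ⟨z', hz', hze⟩ := exists_mem_sallyPowGrading_eq hfg.graded_right z
        (hz ▸ single_mem_fiberGrading l)
      exact ⟨z', hz', hze.trans hz⟩
    choose z hz hzg using hlift
    obtain ⟨x, hx⟩ := (hfg.exact (y - ∑ l, t l • z l)).mp (by
      rw [map_sub, map_sum, sub_eq_zero]
      refine ht.trans (Finset.sum_congr rfl fun l _ => ?_)
      rw [map_smul, hzg])
    rw [← sub_add_cancel y (∑ l, t l • z l), ← hx]
    refine add_mem ?_ (sum_mem fun l _ =>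
      Submodule.smul_mem _ _ (Submodule.subset_span (hz l)))
    have hle : Submodule.span (reesAlgebra Q) (sallyPowGrading h (j + 1) 1) ≤
        (Submodule.span (reesAlgebra Q) (sallyPowGrading h j 1 : Set (sallyPow h j))).comap f :=
      Submodule.span_le.mpr fun w hw => Submodule.subset_span (hfg.graded_left 1 w hw)
    exact hle (ih (j + 1) (by omega) ▸ trivial)

theorem span_sallyGrading_eq_top {n ℓ : ℕ} {s : ℕ → ℕ} (hs : IsSallyFiltration h n ℓ s) :
    Submodule.span (reesAlgebra Q) (sallyGrading h 1 : Set (SallyModule h)) = ⊤ := by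
  have h1 := span_sallyPowGrading_eq_top hs ℓ 0 rfl
  refine eq_top_iff.mpr fun y _ => ?_
  have hle : Submodule.span (reesAlgebra Q) (sallyPowGrading h 0 1 : Set (sallyPow h 0)) ≤
      (Submodule.span (reesAlgebra Q) (sallyGrading h 1 : Set (SallyModule h))).comap
        (sallyPow h 0).subtype :=
    Submodule.span_le.mpr fun w hw => Submodule.subset_span hw
  rw [h1] at hle
  exact hle (x := ⟨y, sallyPow_zero (h := h) ▸ trivial⟩) trivial

theorem localizedLength_fiber [(maxRees Q).IsPrime] (s : ℕ) :
    localizedLength (maxRees Q) (Fin s → FiberRing Q) = s := by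
  have h1 := localizedLength_quotient_self (maxRees Q)
  exact (localizedLength_pi (maxRees Q) (M := FiberRing Q) s).trans (by
    rw [h1, mul_one])

theorem localizedLength_sallyPow [(maxRees Q).IsPrime] {n ℓ : ℕ} {s : ℕ → ℕ}
    (hs : IsSallyFiltration h n ℓ s) (i j : ℕ) (hij : i + j = ℓ) :
    localizedLength (maxRees Q) (sallyPow h j) =
      ((∑ k ∈ Finset.range (i + 1), s k : ℕ) : ℕ∞) := by
  induction i generalizing j with
  | zero =>
    obtain rfl : j = ℓ := by omega
    obtain ⟨e, -⟩ := hs.iso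
    rw [localizedLength_congr _ e, localizedLength_fiber, Finset.sum_range_one]
  | succ i ih =>
    obtain ⟨f, g, hfg⟩ := hs.exact j (by omega)
    rw [localizedLength_eq_add_of_exact _ hfg.injective hfg.exact hfg.surjective,
      ih (j + 1) (by omega), localizedLength_fiber,
      Finset.sum_range_succ _ (i + 1), show ℓ - j = i + 1 by omega, Nat.cast_add]

theorem sallyRankEq [hp : (maxRees Q).IsPrime] {n ℓ : ℕ} {s : ℕ → ℕ}
    (hs : IsSallyFiltration h n ℓ s) : SallyRankEq h n := by
  refine ⟨hp, ?_⟩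
  have h1 := localizedLength_sallyPow hs ℓ 0 rfl
  rw [← hs.sum_eq] at h1
  let e : sallyPow h 0 ≃ₗ[reesAlgebra Q] SallyModule h := LinearEquiv.ofTop _ sallyPow_zero
  exact (localizedLength_congr (maxRees Q) e).symm.trans h1

theorem exists_isFiberExtension {n ℓ : ℕ} {s : ℕ → ℕ} (hs : IsSallyFiltration h n ℓ s)
    (hℓ : 0 < ℓ) : ∃ f g, IsFiberExtension h (ℓ - 1) (s 0) (s 1) f g := by
  obtain ⟨k, rfl⟩ : ∃ k, ℓ = k + 1 := ⟨ℓ - 1, by omega⟩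
  obtain ⟨e, he⟩ := hs.iso
  have hex := hs.exact k (by omega)
  rw [show k + 1 - k = 1 by omega] at hex
  obtain ⟨f, g, hfg⟩ := hex
  refine ⟨f ∘ₗ e.symm.toLinearMap, g, ⟨fun j v hv => ?_, hfg.graded_right, ?_, ?_,
    hfg.surjective⟩⟩
  · refine hfg.graded_left j _ ((he j _).mpr ?_)
    rw [LinearEquiv.coe_coe, LinearEquiv.apply_symm_apply]
    exact hv
  · exact hfg.injective.comp e.symm.injective
  · intro y
    rw [hfg.exact y]
    exact ⟨fun ⟨x, hx⟩ => ⟨e x, by rw [← hx]; simp⟩, fun ⟨x, hx⟩ => ⟨e.symm x, hx⟩⟩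

/-- If `𝔪^k𝒮` were a split extension of sums of copies of `ℬ`, then `𝔪^{k+1}𝒮` would vanish. -/
theorem sallyPow_succ_eq_bot {k a b : ℕ} {f : (Fin a → FiberRing Q) →ₗ[reesAlgebra Q] sallyPow h k}
    {g : sallyPow h k →ₗ[reesAlgebra Q] (Fin b → FiberRing Q)} (hfg : Function.Exact f g)
    {σ : (Fin b → FiberRing Q) →ₗ[reesAlgebra Q] sallyPow h k} (hσ : g ∘ₗ σ = LinearMap.id) :
    sallyPow h (k + 1) = ⊥ := by
  have hkill : ∀ r ∈ maxRees Q, ∀ y : sallyPow h k, r • y = 0 := by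
    intro r hr y
    obtain ⟨v, hv⟩ := (hfg (y - σ (g y))).mp (by
      rw [map_sub, sub_eq_zero]
      exact (LinearMap.congr_fun hσ (g y)).symm)
    rw [← sub_add_cancel y (σ (g y)), ← hv, smul_add, ← map_smul, ← map_smul,
      maxRees_smul_eq_zero hr, maxRees_smul_eq_zero hr, map_zero, map_zero, add_zero]
  rw [sallyPow_succ, eq_bot_iff, Submodule.smul_le]
  intro r hr y hy
  exact congrArg Subtype.val (hkill r hr ⟨y, hy⟩)

theorem not_exists_section [hp : (maxRees Q).IsPrime] {n ℓ : ℕ} {s : ℕ → ℕ}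
    (hs : IsSallyFiltration h n ℓ s) (hℓ : 0 < ℓ)
    {f : (Fin (s 0) → FiberRing Q) →ₗ[reesAlgebra Q] sallyPow h (ℓ - 1)}
    {g : sallyPow h (ℓ - 1) →ₗ[reesAlgebra Q] (Fin (s 1) → FiberRing Q)}
    (hfg : IsFiberExtension h (ℓ - 1) (s 0) (s 1) f g) :
    ¬ ∃ σ : (Fin (s 1) → FiberRing Q) →ₗ[reesAlgebra Q] sallyPow h (ℓ - 1),
      g ∘ₗ σ = LinearMap.id := by
  rintro ⟨σ, hσ⟩
  have hbot : sallyPow h ℓ = ⊥ := by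
    rw [← Nat.sub_add_cancel hℓ]
    exact sallyPow_succ_eq_bot hfg.exact hσ
  obtain ⟨e, -⟩ := hs.iso
  have hsub : Subsingleton (sallyPow h ℓ) := (Submodule.subsingleton_iff_eq_bot).mpr hbot
  have hnt : Nontrivial (FiberRing Q) := Ideal.Quotient.nontrivial_iff.mpr hp.ne_top
  have : Nonempty (Fin (s 0)) := ⟨⟨0, hs.one_le 0 (Nat.zero_le _)⟩⟩
  have := e.symm.injective.subsingleton
  exact not_subsingleton (Fin (s 0) → FiberRing Q) this

end Consequences

/-! ### The filtration of a Sally module generated in degree one -/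

section Filtration

open GotoRing

variable {A : Type u} [CommRing A] [IsLocalRing A] {Q J : Ideal A} (h : Q ≤ J)

/-- `J²/JQ` has finite length: some power of `𝔪` kills it. -/
theorem exists_degreeOneIdeal_eq [IsNoetherianRing A]
    (hrad : Q.radical = maximalIdeal A) : ∃ c, degreeOneIdeal Q J c = J * Q := by
  obtain ⟨c, hc⟩ := Ideal.exists_radical_pow_le_of_fg Q (IsNoetherian.noetherian _)
  refine ⟨c, sup_eq_right.mpr ?_⟩
  rw [← hrad, sq, mul_left_comm]
  exact Ideal.mul_mono_right ((Ideal.mul_mono_left hc).trans Ideal.mul_le_left)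

theorem degreeOneIdeal_eq_of_le_succ [IsNoetherianRing A] {i : ℕ}
    (hi : degreeOneIdeal Q J i ≤ degreeOneIdeal Q J (i + 1)) :
    degreeOneIdeal Q J i = J * Q := by
  refine le_antisymm ?_ le_sup_right
  refine Submodule.le_of_le_smul_of_le_jacobson_bot (I := maximalIdeal A)
    (IsNoetherian.noetherian _) (IsLocalRing.maximalIdeal_le_jacobson _) (hi.trans ?_)
  rw [degreeOneIdeal, degreeOneIdeal, pow_succ', mul_assoc]
  exact sup_le (le_sup_of_le_right (Ideal.mul_mono_right le_sup_left)) le_sup_left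

theorem sallyPow_eq_bot (hpow : ∀ k, J ^ (k + 2) ≤ J ^ 2 * Q ^ k) {i : ℕ}
    (hi : degreeOneIdeal Q J i = J * Q) : sallyPow h i = ⊥ := by
  refine eq_bot_iff.mpr fun y hy => ?_
  induction y using Submodule.Quotient.induction_on with
  | H f =>
    refine (sallyMk_eq_zero_iff h f).mpr fun k => ?_
    rcases k with _ | k
    · simpa using f.2 0
    · have h1 := (sallyMk_mem_sallyPow_iff h hpow i f).mp hy k
      rwa [hi, mul_assoc, ← pow_succ'] at h1

theorem GotoRing.SallyRankEq.sallyPow_zero_ne_bot {n : ℕ} (hrank : SallyRankEq h n) (hn : 1 ≤ n) :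
    sallyPow h 0 ≠ ⊥ := by
  intro hbot
  obtain ⟨hp, hlen⟩ := hrank
  have hsub : Subsingleton (SallyModule h) := by
    rw [← Submodule.subsingleton_iff (reesAlgebra Q)]
    exact subsingleton_of_bot_eq_top (hbot.symm.trans sallyPow_zero)
  have h0 : localizedLength (maxRees Q) (SallyModule h) = 0 := localizedLength_of_subsingleton _
  have h1 : ((0 : ℕ) : ℕ∞) = n := h0.symm.trans hlen
  have := Nat.cast_injective h1
  omega

theorem GotoRing.SallyRankEq.unique {n n' : ℕ} (hn : SallyRankEq h n) (hn' : SallyRankEq h n') :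
    n = n' := by
  obtain ⟨_, h1⟩ := hn
  obtain ⟨_, h2⟩ := hn'
  exact Nat.cast_injective (h1.symm.trans h2)

/-- The integer `ℓ + 1` is the least exponent with `𝔪^{ℓ+1}𝒮 = 0`, and `s_{ℓ-i}` is the dimension
of `𝔪ⁱ [𝒮]₁ / 𝔪ⁱ⁺¹ [𝒮]₁`; their sum is the rank by `sallyRankEq` and the uniqueness of the rank. -/
theorem exists_isStrictSallyFiltration [IsNoetherianRing A]
    [(maxRees Q).IsPrime] (hrad : Q.radical = maximalIdeal A)
    (hpow : ∀ k, J ^ (k + 2) ≤ J ^ 2 * Q ^ k) {m : ℕ} {a : Fin m → A}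
    (hQ : Q = Ideal.span (Set.range a))
    (hform : ∀ (k : ℕ) (F : MvPolynomial (Fin m) A), F.IsHomogeneous k →
      F ∈ (J ^ 2).map MvPolynomial.C → MvPolynomial.eval a F = 0 →
        F ∈ (J * Q).map MvPolynomial.C)
    {n : ℕ} (hn : 1 ≤ n) (hrank : SallyRankEq h n) :
    ∃ ℓ s, IsStrictSallyFiltration h n ℓ s := by
  classical
  have hex := exists_degreeOneIdeal_eq (J := J) hrad
  obtain ⟨ℓ, hℓ⟩ : ∃ ℓ, Nat.find hex = ℓ + 1 := Nat.exists_eq_add_one.mpr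
    (Nat.pos_of_ne_zero fun h0 => GotoRing.SallyRankEq.sallyPow_zero_ne_bot h hrank hn
      (sallyPow_eq_bot h hpow (h0 ▸ Nat.find_spec hex)))
  have hbot : sallyPow h (ℓ + 1) = ⊥ := sallyPow_eq_bot h hpow (hℓ ▸ Nat.find_spec hex)
  choose t g hgr hker hsurj hlift ht using fun i => exists_fiber_quotient h hpow hQ hform i
  have htpos : ∀ i ≤ ℓ, 1 ≤ t i := fun i hi => Nat.one_le_iff_ne_zero.mpr fun h0 =>
    Nat.find_min hex (m := i) (by omega) (degreeOneIdeal_eq_of_le_succ (ht i h0))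
  have hexact : ∀ i, ∀ b, b = t i →
      ∃ g : sallyPow h i →ₗ[reesAlgebra Q] (Fin b → FiberRing Q),
        IsGradedShortExact (sallyPowGrading h (i + 1)) (sallyPowGrading h i)
          (fiberGrading Q b) (Submodule.inclusion (sallyPow_succ_le h i)) g := by
    rintro i _ rfl
    refine ⟨g i, fun j x hx => hx, hgr i, Submodule.inclusion_injective _, fun y => ?_, hsurj i⟩
    rw [hker]
    exact ⟨fun hy => ⟨⟨y, hy⟩, rfl⟩, by rintro ⟨x, rfl⟩; exact x.2⟩
  have hiso : ∀ b, b = t ℓ →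
      GradedIso (reesAlgebra Q) (sallyPowGrading h ℓ) (fiberGrading Q b) := by
    rintro _ rfl
    have hinj : Function.Injective (g ℓ) := (injective_iff_map_eq_zero _).mpr fun y hy => by
      have h1 := (hker ℓ y).mp hy
      rw [hbot] at h1
      exact Subtype.ext h1
    refine ⟨LinearEquiv.ofBijective (g ℓ) ⟨hinj, hsurj ℓ⟩, fun j x => ⟨hgr ℓ j x, fun hx => ?_⟩⟩
    obtain ⟨y, hy, hyx⟩ := hlift ℓ j _ hx
    exact hinj hyx ▸ hy
  let s : ℕ → ℕ := fun i => t (ℓ - i)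
  have hs1 : ∀ i ≤ ℓ, 1 ≤ s i := fun i _ => htpos _ (Nat.sub_le _ _)
  have hlt : ℓ < ∑ i ∈ Finset.range (ℓ + 1), s i := by
    have h1 : ∑ _i ∈ Finset.range (ℓ + 1), 1 ≤ ∑ i ∈ Finset.range (ℓ + 1), s i :=
      Finset.sum_le_sum fun i hi => hs1 i (by rw [Finset.mem_range] at hi; omega)
    rw [Finset.sum_const, Finset.card_range, smul_eq_mul, mul_one] at h1
    exact h1
  have hst : ∀ i < ℓ, s (ℓ - i) = t i := fun i hi => congrArg t (by omega)
  have hfil : IsSallyFiltration h (∑ i ∈ Finset.range (ℓ + 1), s i) ℓ s :=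
    ⟨hlt, hs1, rfl, hiso _ rfl, fun i hi => ⟨_, hexact i _ (hst i hi)⟩⟩
  obtain rfl := GotoRing.SallyRankEq.unique h hrank (sallyRankEq hfil)
  exact ⟨ℓ, s, hfil, fun i hi => hexact i _ (hst i hi)⟩

end Filtration

end

theorem theorem11p8 {A : Type u} [CommRing A] [IsLocalRing A]
    (hA : GotoRing.IsCohenMacaulayLocal A) (hdim : 0 < ringKrullDim A)
    (I : Ideal A) (hI : GotoRing.IsCanonicalIdeal I)
    (Q : Ideal A) (hQ : GotoRing.SatisfiesSharp I Q)
    (J : Ideal A) (hJ : J = I ⊔ Q) (hQJ : Q ≤ J)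
    (n : ℕ) (hn : 1 ≤ n) :
    List.TFAE
      [ GotoRing.IsGotoWithRespectTo I Q n,
        ∃ (ℓ : ℕ) (s : ℕ → ℕ), GotoRing.IsSallyFiltration hQJ n ℓ s,
        ∃ (ℓ : ℕ) (s : ℕ → ℕ), GotoRing.IsStrictSallyFiltration hQJ n ℓ s ] ∧
    ∀ (ℓ : ℕ) (s : ℕ → ℕ), GotoRing.IsSallyFiltration hQJ n ℓ s → 0 < ℓ →
      (∃ f g, GotoRing.IsFiberExtension hQJ (ℓ - 1) (s 0) (s 1) f g) ∧
      ∀ f g, GotoRing.IsFiberExtension hQJ (ℓ - 1) (s 0) (s 1) f g →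
        ¬ ∃ σ : (Fin (s 1) → GotoRing.FiberRing Q) →ₗ[reesAlgebra Q]
            GotoRing.sallyPow hQJ (ℓ - 1), g ∘ₗ σ = LinearMap.id := by
  have : IsNoetherianRing A := hA.1
  obtain ⟨m, a, ha, hrad, hreg, hform⟩ := hQ.exists_isQuasiRegular hA hI
  subst hJ
  have hprime : (GotoRing.maxRees Q).IsPrime := by
    have hle : Q ≤ maximalIdeal A := hrad ▸ Ideal.le_radical
    subst ha
    exact isPrime_maxRees hreg hle
  refine ⟨?_, fun ℓ s hs hℓ =>
    ⟨exists_isFiberExtension hs hℓ, fun f g hfg => not_exists_section hs hℓ hfg⟩⟩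
  tfae_have 1 → 3 := fun hgoto =>
    exists_isStrictSallyFiltration hQJ hrad (pow_le_of_span_eq_top hQJ hgoto.1) ha hform hn hgoto.2
  tfae_have 3 → 2 := fun ⟨ℓ, s, hs⟩ => ⟨ℓ, s, hs.1⟩
  tfae_have 2 → 1 := fun ⟨ℓ, s, hs⟩ => ⟨span_sallyGrading_eq_top hs, sallyRankEq hs⟩
  tfae_finish
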